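/- Theorem 7. Let $G$ be a finite simple undirected graph. A set $S\subseteq V(G)$ is a *separated-cluster* of $G$ if no two vertices of $S$ are at distance exactly $2$ in $G$, and the *separated-cluster number* $\omega_s(G)$ is the largest size of a separated-cluster of $G$. A graph is an *interval graph* if its vertices can be assigned closed intervals of the real line such that two distinct vertices are adjacent if and only if their intervals intersect. The problem Separated-Cluster is solvable in polynomial time on interval graphs. That is, there are a polynomial $p$ and an algorithm (a program for a random access machine with unit-cost addition and subtraction of natural numbers, and no multiplication) that, given the adjacency matrix of an interval graph $G$ on $n$ vertices and a natural number $k$, decides within $p(n)$ steps whether $G$ has a separated-cluster of size at least $k$. Likewise, there are a polynomial $q$ and such an algorithm that, given the adjacency matrix of an interval graph $G$ on $n$ vertices, computes $\omega_s(G)$ within $q(n)$ steps. An interval representation of $G$ is not part of the input. -/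

import Mathlib

/-! ### Separated-clusters and interval graphs -/

namespace SepCluster

/-- A set of vertices is a separated-cluster if no two of its vertices are at distance exactly `2`.
(`SimpleGraph.dist` is `0` for vertices in different components, so such pairs are allowed.) -/
def IsSeparatedCluster {V : Type*} (G : SimpleGraph V) (S : Finset V) : Prop :=
  ∀ u ∈ S, ∀ v ∈ S, G.dist u v ≠ 2

/-- The separated-cluster number: the largest size of a separated-cluster. On a finite vertex set
the set of sizes is bounded, and it contains `0`. -/
noncomputable def separatedClusterNumber {V : Type*} [Finite V] (G : SimpleGraph V) : ℕ :=
  sSup {k | ∃ S : Finset V, IsSeparatedCluster G S ∧ S.card = k}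

/-- A graph is an interval graph if one can assign to every vertex `v` a nonempty closed interval
`[l v, r v]` of the real line so that distinct vertices are adjacent if and only if their intervals
intersect. -/
def IsIntervalGraph {V : Type*} (G : SimpleGraph V) : Prop :=
  ∃ l r : V → ℝ, (∀ v, l v ≤ r v) ∧
    ∀ u v, u ≠ v → (G.Adj u v ↔ (Set.Icc (l u) (r u) ∩ Set.Icc (l v) (r v)).Nonempty)

/-! ### Random access programs with a step count

Structured programs for a random access machine whose only arithmetic is addition and truncated
subtraction of natural numbers. Every evaluation of a node of an expression and every execution of
an assignment or a test takes one step. As there is no multiplication, numbers have at most `t + O(1)`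
bits more than the input numbers after `t` steps, so that polynomial time on this machine is
polynomial time on Turing machines. -/

/-- A state of the machine: registers holding natural numbers, and arrays of natural numbers,
where `arr a i` is the `i`-th entry of the `a`-th array. -/
structure State where
  reg : ℕ → ℕ
  arr : ℕ → ℕ → ℕ

/-- Expressions: constants, registers, array entries at a computed index, sums and truncated
differences. -/
inductive Expr where
  | const (c : ℕ)
  | reg (x : ℕ)
  | read (a : ℕ) (i : Expr)
  | add (e f : Expr)
  | sub (e f : Expr)

/-- The value of an expression. -/
def Expr.eval (s : State) : Expr → ℕ
  | .const c => c
  | .reg x => s.reg x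
  | .read a i => s.arr a (i.eval s)
  | .add e f => e.eval s + f.eval s
  | .sub e f => e.eval s - f.eval s

/-- The number of steps that the evaluation of an expression takes. -/
def Expr.cost : Expr → ℕ
  | .const _ => 1
  | .reg _ => 1
  | .read _ i => i.cost + 1
  | .add e f => e.cost + f.cost + 1
  | .sub e f => e.cost + f.cost + 1

/-- Programs. In `ite` and `loop` the test succeeds if the expression is not zero. -/
inductive Prog where
  | skip
  | assign (x : ℕ) (e : Expr)
  | write (a : ℕ) (i e : Expr)
  | seq (P Q : Prog)
  | ite (e : Expr) (P Q : Prog)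
  | loop (e : Expr) (P : Prog)

/-- Set the register `x` to the value `v`. -/
def State.setReg (s : State) (x v : ℕ) : State :=
  { s with reg := Function.update s.reg x v }

/-- Set the `i`-th entry of the array `a` to the value `v`. -/
def State.setArr (s : State) (a i v : ℕ) : State :=
  { s with arr := Function.update s.arr a (Function.update (s.arr a) i v) }

/-- `Exec P s t s'`: started in the state `s`, the program `P` halts in the state `s'` after exactly
`t` steps. -/
inductive Exec : Prog → State → ℕ → State → Prop where
  | skip (s : State) : Exec .skip s 1 s
  | assign (x : ℕ) (e : Expr) (s : State) :
      Exec (.assign x e) s (e.cost + 1) (s.setReg x (e.eval s))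
  | write (a : ℕ) (i e : Expr) (s : State) :
      Exec (.write a i e) s (i.cost + e.cost + 1) (s.setArr a (i.eval s) (e.eval s))
  | seq {P Q : Prog} {s s' s'' : State} {t t' : ℕ} :
      Exec P s t s' → Exec Q s' t' s'' → Exec (.seq P Q) s (t + t') s''
  | ite_true {e : Expr} {P Q : Prog} {s s' : State} {t : ℕ} :
      e.eval s ≠ 0 → Exec P s t s' → Exec (.ite e P Q) s (e.cost + 1 + t) s'
  | ite_false {e : Expr} {P Q : Prog} {s s' : State} {t : ℕ} :
      e.eval s = 0 → Exec Q s t s' → Exec (.ite e P Q) s (e.cost + 1 + t) s'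
  | loop_false {e : Expr} {P : Prog} {s : State} :
      e.eval s = 0 → Exec (.loop e P) s (e.cost + 1) s
  | loop_true {e : Expr} {P : Prog} {s s' s'' : State} {t t' : ℕ} :
      e.eval s ≠ 0 → Exec P s t s' → Exec (.loop e P) s' t' s'' →
      Exec (.loop e P) s (e.cost + 1 + t + t') s''

/-- Started in the state `s`, the program `P` halts within `T` steps with `out` in register `0`. -/
def OutputsWithin (P : Prog) (s : State) (T out : ℕ) : Prop :=
  ∃ t ≤ T, ∃ s', Exec P s t s' ∧ s'.reg 0 = out

open Classical in
/-- The initial state for an input that consists of a graph on `n` vertices and a number `k`: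
register `0` holds `n`, register `1` holds `k`, and array `0` holds the adjacency matrix, row by
row, as zeros and ones. Everything else is zero. -/
noncomputable def inputState {n : ℕ} (G : SimpleGraph (Fin n)) (k : ℕ) : State where
  reg x := if x = 0 then n else if x = 1 then k else 0
  arr a i := if a = 0 ∧ ∃ u v : Fin n, i = n * u + v ∧ G.Adj u v then 1 else 0

open Classical in
/-- The program `P` solves the decision problem Separated-Cluster on the class `𝒞` of graphs
in polynomial time: on a graph `G` of the class with `n` vertices and a number `k` it decides
within `p(n)` steps whether `G` has a separated-cluster of size at least `k`. -/
def DecidesSeparatedCluster (P : Prog) (𝒞 : ∀ n : ℕ, SimpleGraph (Fin n) → Prop) : Prop :=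
  ∃ p : Polynomial ℕ, ∀ (n : ℕ) (G : SimpleGraph (Fin n)), 𝒞 n G → ∀ k : ℕ,
    OutputsWithin P (inputState G k) (p.eval n)
      (if ∃ S : Finset (Fin n), IsSeparatedCluster G S ∧ k ≤ S.card then 1 else 0)

/-- The program `P` computes the separated-cluster number of the graphs of the class `𝒞`
in polynomial time. -/
def ComputesSeparatedClusterNumber (P : Prog) (𝒞 : ∀ n : ℕ, SimpleGraph (Fin n) → Prop) : Prop :=
  ∃ p : Polynomial ℕ, ∀ (n : ℕ) (G : SimpleGraph (Fin n)), 𝒞 n G →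
    OutputsWithin P (inputState G 0) (p.eval n) (separatedClusterNumber G)

end SepCluster

/-! Two vertices of a separated-cluster with a common closed neighbour are equal or adjacent
(`dist_eq_two_iff`), so the set splits into cliques with pairwise disjoint closed neighbourhoods. In
an interval graph the closed neighbourhood of a clique is that of two of its vertices, the one
starting first and the one ending last. Hence cliques can be traded for the n² pairs of vertices: a
pair is weighted by the size of a clique inside its closed neighbourhood, pairs conflict if their
closed neighbourhoods meet, and the separated-cluster number is the largest weight of a
conflict-free set of pairs (`IsIntervalGraph.isGreatest_maxWeight`).

No representation is given, so the algorithm uses adjacency alone. The cliques are found as common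
closed neighbours of two vertices (`IsIntervalGraph.exists_card_le_cliqueWeight`). The maximum
weight is found as in Frank's algorithm for chordal graphs: if the positive-weight elements in
conflict with p are pairwise in conflict, subtracting the weight of p from all of them lowers the
optimum by exactly that weight (`maxWeight_eq_of_isSimplicial`). Such a p exists as long as some
weight is positive: a pair whose closed neighbourhood ends first
(`IsIntervalGraph.exists_isSimplicial`). A pass over all pairs clears at least one, so n² passes
suffice.

The algorithm is written in a language whose only loops have n rounds, and is compiled to the
machine; polynomial time then follows by structural induction (`BoundedProg.exists_implementedBy`).
Registers 0 and 1 keep the input, even registers from 2 on are variables, and odd ones from 3 on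
form a stack of temporaries. -/

namespace SepCluster

/-! ### Programs whose loops are bounded by the size of the graph -/

/-- Expressions over named variables and arrays, with sums over all numbers below the
number `n` of vertices. -/
inductive BoundedExpr where
  | const (c : ℕ)
  | var (x : ℕ)
  | read (a : ℕ) (i : BoundedExpr)
  | add (e f : BoundedExpr)
  | sub (e f : BoundedExpr)
  | ite (c e f : BoundedExpr)
  | sum (x : ℕ) (e : BoundedExpr)

/-- The value of a bounded expression; variables are the registers of the state. -/
def BoundedExpr.eval (n : ℕ) : BoundedExpr → State → ℕ
  | .const c, _ => c
  | .var x, s => s.reg x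
  | .read a i, s => s.arr a (i.eval n s)
  | .add e f, s => e.eval n s + f.eval n s
  | .sub e f, s => e.eval n s - f.eval n s
  | .ite c e f, s => if c.eval n s ≠ 0 then e.eval n s else f.eval n s
  | .sum x e, s => ∑ i : Fin n, e.eval n (s.setReg x i)

/-- Programs all of whose loops run over the numbers below the number of vertices. -/
inductive BoundedProg where
  | set (x : ℕ) (e : BoundedExpr)
  | write (a : ℕ) (i e : BoundedExpr)
  | seq (P Q : BoundedProg)
  | forLoop (x : ℕ) (P : BoundedProg)

/-- The state after running a bounded program. -/
def BoundedProg.run (n : ℕ) : BoundedProg → State → State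
  | .set x e, s => s.setReg x (e.eval n s)
  | .write a i e, s => s.setArr a (i.eval n s) (e.eval n s)
  | .seq P Q, s => Q.run n (P.run n s)
  | .forLoop x P, s => (List.range n).foldl (fun s i => P.run n (s.setReg x i)) s

/-- The variables of a machine state: variable `x` is kept in register `2 * x + 2`. -/
def State.vars (s : State) : State := ⟨fun x => s.reg (2 * x + 2), s.arr⟩

/-- The states `s` and `s'` differ only in the temporary registers `2 * j + 3` with `d ≤ j`. -/
def State.Frame (d : ℕ) (s s' : State) : Prop :=
  s'.arr = s.arr ∧ ∀ y, (∀ j, d ≤ j → y ≠ 2 * j + 3) → s'.reg y = s.reg y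

theorem State.Frame.vars {d : ℕ} {s s' : State} (h : s.Frame d s') : s'.vars = s.vars := by
  simp only [State.vars, State.mk.injEq, h.1, and_true]
  funext x
  exact h.2 _ fun j _ => by omega

theorem State.Frame.reg_zero {d : ℕ} {s s' : State} (h : s.Frame d s') : s'.reg 0 = s.reg 0 :=
  h.2 _ fun j _ => by omega

theorem State.Frame.reg_temp {d j : ℕ} {s s' : State} (h : s.Frame d s') (hj : j < d) :
    s'.reg (2 * j + 3) = s.reg (2 * j + 3) :=
  h.2 _ fun i _ => by omega

theorem State.Frame.trans {d d' : ℕ} {s s' s'' : State} (h : s.Frame d s') (h' : s'.Frame d' s'')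
    (hd : d ≤ d') : s.Frame d s'' :=
  ⟨h'.1.trans h.1, fun y hy =>
    (h'.2 y fun j hj => hy j (hd.trans hj)).trans (h.2 y hy)⟩

theorem State.frame_setReg (d j v : ℕ) (s : State) (h : d ≤ j) :
    s.Frame d (s.setReg (2 * j + 3) v) := by
  refine ⟨rfl, fun y hy => ?_⟩
  simp [State.setReg, Function.update_of_ne (hy j h)]

theorem State.reg_setReg_self (s : State) (x v : ℕ) : (s.setReg x v).reg x = v := by
  simp [State.setReg]

theorem State.reg_setReg_of_ne (s : State) {x y : ℕ} (v : ℕ) (h : y ≠ x) :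
    (s.setReg x v).reg y = s.reg y := by
  simp [State.setReg, Function.update_of_ne h]

@[simp]
theorem State.arr_setReg (s : State) (x v : ℕ) : (s.setReg x v).arr = s.arr := rfl

theorem State.vars_setReg (s : State) (x v : ℕ) :
    (s.setReg (2 * x + 2) v).vars = s.vars.setReg x v := by
  simp only [State.vars, State.setReg, State.mk.injEq, and_true]
  funext y
  simp [Function.update_apply]

/-- A loop that counts register `r` up to the value of register `0`. -/
theorem exec_counting_loop {n r T : ℕ} {B : Prog} (I : ℕ → State → Prop)
    (hI : ∀ i s, I i s → s.reg 0 = n ∧ s.reg r = i)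
    (hB : ∀ i s, i < n → I i s → ∃ t ≤ T, ∃ s', Exec B s t s' ∧ I (i + 1) s')
    (s : State) (hs : I 0 s) :
    ∃ t ≤ n * (T + 4) + 4, ∃ s', Exec (.loop (.sub (.reg 0) (.reg r)) B) s t s' ∧ I n s' := by
  -- Induction on the number k of rounds left. Every test costs 4 steps, 3 for the difference and 1
  -- for the branch, including the last test, which fails.
  suffices H : ∀ k i s, i + k = n → I i s → ∃ t ≤ k * (T + 4) + 4, ∃ s',
      Exec (.loop (.sub (.reg 0) (.reg r)) B) s t s' ∧ I n s' from H n 0 s (zero_add n) hs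
  intro k
  induction k with
  | zero =>
    intro i s hi hs
    obtain rfl : i = n := hi
    refine ⟨_, ?_, s, Exec.loop_false ?_, hs⟩
    · simp [Expr.cost]
    · simp [Expr.eval, (hI _ _ hs).1, (hI _ _ hs).2]
  | succ k ih =>
    intro i s hi hs
    obtain ⟨t, ht, s', he, hs'⟩ := hB i s (by omega) hs
    obtain ⟨t', ht', s'', he', hs''⟩ := ih (i + 1) s' (by omega) hs'
    refine ⟨_, ?_, s'', Exec.loop_true ?_ he he', hs''⟩
    · simp only [Expr.cost, add_mul, one_mul]
      omega
    · simp only [Expr.eval, (hI _ _ hs).1, (hI _ _ hs).2]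
      omega

/-- `P` computes the expression `e` into the temporary register `2 * d + 3` within `p(n)` steps. -/
def BoundedExpr.ComputedBy (e : BoundedExpr) (d : ℕ) (P : Prog) (p : Polynomial ℕ) : Prop :=
  ∀ s : State, ∃ t ≤ p.eval (s.reg 0), ∃ s', Exec P s t s' ∧
    s'.reg (2 * d + 3) = e.eval (s.reg 0) s.vars ∧ s.Frame d s'

/-- The second operand is evaluated one level higher on the stack of temporaries, so the value of
the first survives. -/
theorem BoundedExpr.computedBy_binary {e f g : BoundedExpr} {d : ℕ} {P Q : Prog}
    {p q : Polynomial ℕ} (op : Expr → Expr → Expr) (o : ℕ → ℕ → ℕ)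
    (hcost : ∀ a b, (op a b).cost = a.cost + b.cost + 1)
    (hop : ∀ s a b, (op a b).eval s = o (a.eval s) (b.eval s))
    (hg : ∀ n s, g.eval n s = o (e.eval n s) (f.eval n s))
    (hP : e.ComputedBy d P p) (hQ : f.ComputedBy (d + 1) Q q) :
    g.ComputedBy d (.seq (.seq P Q)
      (.assign (2 * d + 3) (op (.reg (2 * d + 3)) (.reg (2 * (d + 1) + 3))))) (p + q + 4) := by
  intro s
  obtain ⟨t, ht, s', he, hv, hf⟩ := hP s
  obtain ⟨t', ht', s'', he', hv', hf'⟩ := hQ s'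
  refine ⟨_, ?_, _, Exec.seq (Exec.seq he he') (Exec.assign _ _ _), ?_, ?_⟩
  · rw [hf.reg_zero] at ht'
    simp [hcost, Expr.cost]
    omega
  · rw [State.reg_setReg_self, hop, hg]
    simp only [Expr.eval]
    rw [hf'.reg_temp (Nat.lt_succ_self d), hv, hv', hf.vars, hf.reg_zero]
  · exact (hf.trans hf' (Nat.le_succ d)).trans (State.frame_setReg d d _ _ le_rfl) le_rfl

/-- Every bounded expression is computed by a program in polynomial time. -/
theorem BoundedExpr.exists_computedBy (e : BoundedExpr) (d : ℕ) :
    ∃ P p, e.ComputedBy d P p := by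
  induction e generalizing d with
  | const c =>
    refine ⟨.assign (2 * d + 3) (.const c), 2, fun s =>
      ⟨_, ?_, _, Exec.assign _ _ _, ?_, State.frame_setReg d d _ _ le_rfl⟩⟩
    · simp [Expr.cost]
    · simp [State.reg_setReg_self, Expr.eval, BoundedExpr.eval]
  | var x =>
    refine ⟨.assign (2 * d + 3) (.reg (2 * x + 2)), 2, fun s =>
      ⟨_, ?_, _, Exec.assign _ _ _, ?_, State.frame_setReg d d _ _ le_rfl⟩⟩
    · simp [Expr.cost]
    · simp [State.reg_setReg_self, Expr.eval, BoundedExpr.eval, State.vars]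
  | read a i ih =>
    obtain ⟨P, p, hP⟩ := ih d
    refine ⟨.seq P (.assign (2 * d + 3) (.read a (.reg (2 * d + 3)))), p + 3, fun s => ?_⟩
    obtain ⟨t, ht, s', he, hv, hf⟩ := hP s
    refine ⟨_, ?_, _, Exec.seq he (Exec.assign _ _ _), ?_,
      hf.trans (State.frame_setReg d d _ _ le_rfl) le_rfl⟩
    · simp [Expr.cost]
      omega
    · simp [State.reg_setReg_self, Expr.eval, BoundedExpr.eval, hv, hf.1, State.vars]
  | add e f ihe ihf =>
    obtain ⟨P, p, hP⟩ := ihe d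
    obtain ⟨Q, q, hQ⟩ := ihf (d + 1)
    exact ⟨_, _, computedBy_binary .add (· + ·) (fun _ _ => rfl) (fun _ _ _ => rfl)
      (fun _ _ => rfl) hP hQ⟩
  | sub e f ihe ihf =>
    obtain ⟨P, p, hP⟩ := ihe d
    obtain ⟨Q, q, hQ⟩ := ihf (d + 1)
    exact ⟨_, _, computedBy_binary .sub (· - ·) (fun _ _ => rfl) (fun _ _ _ => rfl)
      (fun _ _ => rfl) hP hQ⟩
  | ite c e f ihc ihe ihf =>
    obtain ⟨R, r, hR⟩ := ihc d
    obtain ⟨P, p, hP⟩ := ihe d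
    obtain ⟨Q, q, hQ⟩ := ihf d
    refine ⟨.seq R (.ite (.reg (2 * d + 3)) P Q), r + p + q + 2, fun s => ?_⟩
    obtain ⟨t, ht, s', he, hv, hf⟩ := hR s
    by_cases hc : c.eval (s.reg 0) s.vars = 0
    · obtain ⟨t', ht', s'', he', hv', hf'⟩ := hQ s'
      rw [hf.reg_zero] at ht' hv'
      refine ⟨_, ?_, s'', Exec.seq he (Exec.ite_false (by simpa [Expr.eval, hv] using hc) he'),
        ?_, hf.trans hf' le_rfl⟩
      · simp [Expr.cost]
        omega
      · simp [BoundedExpr.eval, hc, hv', hf.vars]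
    · obtain ⟨t', ht', s'', he', hv', hf'⟩ := hP s'
      rw [hf.reg_zero] at ht' hv'
      refine ⟨_, ?_, s'', Exec.seq he (Exec.ite_true (by simpa [Expr.eval, hv] using hc) he'),
        ?_, hf.trans hf' le_rfl⟩
      · simp [Expr.cost]
        omega
      · simp [BoundedExpr.eval, hc, hv', hf.vars]
  | sum x e ih =>
    obtain ⟨P, p, hP⟩ := ih (d + 3)
    -- `2 * d + 3` accumulates, `2 * (d + 1) + 3` counts, `2 * (d + 2) + 3` keeps the old `x`
    set B : Prog := .seq (.seq (.seq (.assign (2 * x + 2) (.reg (2 * (d + 1) + 3))) P)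
      (.assign (2 * d + 3) (.add (.reg (2 * d + 3)) (.reg (2 * (d + 3) + 3)))))
      (.assign (2 * (d + 1) + 3) (.add (.reg (2 * (d + 1) + 3)) (.const 1)))
    refine ⟨.seq (.seq (.seq (.seq (.assign (2 * d + 3) (.const 0))
      (.assign (2 * (d + 1) + 3) (.const 0))) (.assign (2 * (d + 2) + 3) (.reg (2 * x + 2))))
      (.loop (.sub (.reg 0) (.reg (2 * (d + 1) + 3))) B))
      (.assign (2 * x + 2) (.reg (2 * (d + 2) + 3))),
      -- The three assignments of `B` cost 2 + 4 + 4 and the loop test 4. The four assignments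
      -- outside cost 2 each, the failing test 4.
      .X * (p + 10 + 4) + 12, fun s => ?_⟩
    set n := s.reg 0 with hn
    -- The register of `x` is exempt from the frame condition during the loop; it is restored
    -- afterwards from the saved copy.
    let I : ℕ → State → Prop := fun i s' => s'.arr = s.arr ∧
      (∀ y, (∀ j, d ≤ j → y ≠ 2 * j + 3) → y ≠ 2 * x + 2 → s'.reg y = s.reg y) ∧
      s'.reg (2 * (d + 2) + 3) = s.reg (2 * x + 2) ∧ s'.reg (2 * (d + 1) + 3) = i ∧
      s'.reg (2 * d + 3) = ∑ j ∈ Finset.range i, e.eval n (s.vars.setReg x j)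
    obtain ⟨t, ht, s', he, hI⟩ := exec_counting_loop (n := n) (r := 2 * (d + 1) + 3)
      (T := p.eval n + 10) (B := B) I
      (fun i s' h => ⟨h.2.1 0 (fun j _ => by omega) (by omega), h.2.2.2.1⟩)
      (by
        rintro i s₁ - ⟨h1, h2, h3, h4, h5⟩
        set s₂ := s₁.setReg (2 * x + 2) i with hs₂
        have h0 : s₂.reg 0 = n := by
          rw [hs₂, State.reg_setReg_of_ne _ _ (by omega)]
          exact h2 0 (fun j _ => by omega) (by omega)
        have hvars : s₂.vars = s.vars.setReg x i := by
          rw [hs₂, State.vars_setReg]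
          simp only [State.vars, State.setReg, State.mk.injEq, h1, and_true]
          funext y
          by_cases hy : y = x
          · simp [hy]
          · simp only [Function.update_of_ne hy]
            exact h2 _ (fun j _ => by omega) (by omega)
        obtain ⟨t, ht, s₃, he, hv, hf⟩ := hP s₂
        rw [h0] at ht hv
        rw [hvars] at hv
        have he : Exec P (s₁.setReg (2 * x + 2) (Expr.eval s₁ (.reg (2 * (d + 1) + 3)))) t s₃ := by
          rwa [Expr.eval, h4]
        refine ⟨_, ?_, _, Exec.seq (Exec.seq (Exec.seq (Exec.assign _ _ _) he)
          (Exec.assign _ _ _)) (Exec.assign _ _ _), ?_⟩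
        · simp [Expr.cost]
          omega
        · have e0 : s₃.reg (2 * d + 3) = s₁.reg (2 * d + 3) := by
            rw [hf.reg_temp (by omega), hs₂, State.reg_setReg_of_ne _ _ (by omega)]
          have e1 : s₃.reg (2 * (d + 1) + 3) = i := by
            rw [hf.reg_temp (by omega), hs₂, State.reg_setReg_of_ne _ _ (by omega), h4]
          have e2 : s₃.reg (2 * (d + 2) + 3) = s.reg (2 * x + 2) := by
            rw [hf.reg_temp (by omega), hs₂, State.reg_setReg_of_ne _ _ (by omega), h3]
          refine ⟨?_, ?_, ?_, ?_, ?_⟩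
          · simp [hf.1, hs₂, h1]
          · intro y hy hyx
            rw [State.reg_setReg_of_ne _ _ (hy _ (by omega)),
              State.reg_setReg_of_ne _ _ (hy _ le_rfl), hf.2 y fun j hj => hy j (by omega), hs₂,
              State.reg_setReg_of_ne _ _ hyx, h2 y hy hyx]
          · rw [State.reg_setReg_of_ne _ _ (by omega), State.reg_setReg_of_ne _ _ (by omega), e2]
          · rw [State.reg_setReg_self]
            simp only [Expr.eval]
            rw [State.reg_setReg_of_ne _ _ (by omega), e1]
          · rw [State.reg_setReg_of_ne _ _ (by omega), State.reg_setReg_self]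
            simp only [Expr.eval]
            rw [e0, h5, hv, Finset.sum_range_succ])
      (((s.setReg (2 * d + 3) 0).setReg (2 * (d + 1) + 3) 0).setReg (2 * (d + 2) + 3)
        (s.reg (2 * x + 2)))
      (by
        refine ⟨rfl, ?_, ?_, ?_, ?_⟩
        · intro y hy hyx
          rw [State.reg_setReg_of_ne _ _ (hy _ (by omega)),
            State.reg_setReg_of_ne _ _ (hy _ (by omega)), State.reg_setReg_of_ne _ _ (hy _ le_rfl)]
        · rw [State.reg_setReg_self]
        · rw [State.reg_setReg_of_ne _ _ (by omega), State.reg_setReg_self]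
        · rw [State.reg_setReg_of_ne _ _ (by omega), State.reg_setReg_of_ne _ _ (by omega),
            State.reg_setReg_self]
          simp)
    obtain ⟨h1, h2, h3, h4, h5⟩ := hI
    have hx : s.reg (2 * x + 2) = Expr.eval ((s.setReg (2 * d + 3) 0).setReg (2 * (d + 1) + 3) 0)
        (.reg (2 * x + 2)) := by
      rw [Expr.eval, State.reg_setReg_of_ne _ _ (by omega), State.reg_setReg_of_ne _ _ (by omega)]
    rw [hx] at he
    refine ⟨_, ?_, _, Exec.seq (Exec.seq (Exec.seq (Exec.seq (Exec.assign _ (.const 0) _)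
      (Exec.assign _ (.const 0) _)) (Exec.assign _ _ _)) he) (Exec.assign _ _ _), ?_, ?_, ?_⟩
    · simp [Expr.cost]
      omega
    · rw [State.reg_setReg_of_ne _ _ (by omega), h5, BoundedExpr.eval,
        Finset.sum_range fun j => e.eval n (s.vars.setReg x j)]
    · exact h1
    · intro y hy
      by_cases hyx : y = 2 * x + 2
      · rw [hyx, State.reg_setReg_self, Expr.eval, h3]
      · rw [State.reg_setReg_of_ne _ _ hyx, h2 y hy hyx]

/-- The machine program `Q` runs the bounded program `P` within `p(n)` steps, keeping the registers
`0` and `1` and the temporary registers below `2 * d + 3`. -/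
def BoundedProg.ImplementedBy (P : BoundedProg) (d : ℕ) (Q : Prog) (p : Polynomial ℕ) : Prop :=
  ∀ s : State, ∃ t ≤ p.eval (s.reg 0), ∃ s', Exec Q s t s' ∧
    s'.vars = P.run (s.reg 0) s.vars ∧ s'.reg 0 = s.reg 0 ∧ s'.reg 1 = s.reg 1 ∧
    ∀ j < d, s'.reg (2 * j + 3) = s.reg (2 * j + 3)

/-- Every bounded program is run by a machine program in polynomial time. -/
theorem BoundedProg.exists_implementedBy (P : BoundedProg) (d : ℕ) :
    ∃ Q p, P.ImplementedBy d Q p := by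
  induction P generalizing d with
  | set x e =>
    obtain ⟨Q, p, hQ⟩ := e.exists_computedBy d
    refine ⟨.seq Q (.assign (2 * x + 2) (.reg (2 * d + 3))), p + 2, fun s => ?_⟩
    obtain ⟨t, ht, s', he, hv, hf⟩ := hQ s
    refine ⟨_, ?_, _, Exec.seq he (Exec.assign _ _ _), ?_, ?_, ?_, fun j hj => ?_⟩
    · simp [Expr.cost]
      omega
    · rw [State.vars_setReg, hf.vars, Expr.eval, hv, BoundedProg.run]
    · rw [State.reg_setReg_of_ne _ _ (by omega), hf.reg_zero]
    · rw [State.reg_setReg_of_ne _ _ (by omega), hf.2 1 fun j _ => by omega]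
    · rw [State.reg_setReg_of_ne _ _ (by omega), hf.reg_temp hj]
  | write a i e =>
    obtain ⟨Q, p, hQ⟩ := i.exists_computedBy d
    obtain ⟨R, r, hR⟩ := e.exists_computedBy (d + 1)
    refine ⟨.seq (.seq Q R) (.write a (.reg (2 * d + 3)) (.reg (2 * (d + 1) + 3))), p + r + 3,
      fun s => ?_⟩
    obtain ⟨t, ht, s', he, hv, hf⟩ := hQ s
    obtain ⟨t', ht', s'', he', hv', hf'⟩ := hR s'
    rw [hf.reg_zero] at ht' hv'
    have hff := hf.trans hf' (Nat.le_succ d)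
    refine ⟨_, ?_, _, Exec.seq (Exec.seq he he') (Exec.write _ _ _ _), ?_, ?_, ?_, fun j hj => ?_⟩
    · simp [Expr.cost]
      omega
    · simp only [Expr.eval, hf'.reg_temp (Nat.lt_succ_self d), hv, hv', hf.vars, BoundedProg.run]
      have := hff.vars
      simp only [State.vars, State.mk.injEq] at this
      simp only [State.vars, State.setArr, hff.1, State.mk.injEq, and_true]
      exact this.1
    · exact hff.reg_zero
    · exact hff.2 1 fun j _ => by omega
    · exact hff.reg_temp hj
  | seq P Q ihP ihQ =>
    obtain ⟨P', p, hP⟩ := ihP d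
    obtain ⟨Q', q, hQ⟩ := ihQ d
    refine ⟨.seq P' Q', p + q, fun s => ?_⟩
    obtain ⟨t, ht, s', he, hv, h0, h1, hf⟩ := hP s
    obtain ⟨t', ht', s'', he', hv', h0', h1', hf'⟩ := hQ s'
    rw [h0] at ht' hv'
    refine ⟨_, ?_, _, Exec.seq he he', ?_, h0'.trans h0, h1'.trans h1,
      fun j hj => (hf' j hj).trans (hf j hj)⟩
    · simp
      omega
    · rw [hv', hv, BoundedProg.run]
  | forLoop x P ih =>
    obtain ⟨Q, p, hQ⟩ := ih (d + 1)
    -- The round is counted in temporary `d`, which a body compiled at depth `d + 1` preserves; the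
    -- body may even overwrite `x`.
    set B : Prog := .seq (.seq (.assign (2 * x + 2) (.reg (2 * d + 3))) Q)
      (.assign (2 * d + 3) (.add (.reg (2 * d + 3)) (.const 1)))
    refine ⟨.seq (.assign (2 * d + 3) (.const 0))
      (.loop (.sub (.reg 0) (.reg (2 * d + 3))) B), .X * (p + 6 + 4) + 6, fun s => ?_⟩
    set n := s.reg 0 with hn
    let I : ℕ → State → Prop := fun i s' =>
      s'.vars = (List.range i).foldl (fun s i => P.run n (s.setReg x i)) s.vars ∧
      s'.reg 0 = n ∧ s'.reg 1 = s.reg 1 ∧ s'.reg (2 * d + 3) = i ∧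
      ∀ j < d, s'.reg (2 * j + 3) = s.reg (2 * j + 3)
    obtain ⟨t, ht, s', he, hv, h0, h1, -, hf⟩ := exec_counting_loop (n := n) (r := 2 * d + 3)
      (T := p.eval n + 6) (B := B) I (fun i s' h => ⟨h.2.1, h.2.2.2.1⟩)
      (by
        rintro i s₁ - ⟨hv, h0, h1, hi, hf⟩
        obtain ⟨t, ht, s₃, he, hv', h0', h1', hf'⟩ := hQ (s₁.setReg (2 * x + 2) i)
        rw [State.reg_setReg_of_ne _ _ (by omega)] at ht hv' h0' h1'
        rw [h0] at ht hv'
        have he : Exec Q (s₁.setReg (2 * x + 2) (Expr.eval s₁ (.reg (2 * d + 3)))) t s₃ := by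
          rwa [Expr.eval, hi]
        refine ⟨_, ?_, _, Exec.seq (Exec.seq (Exec.assign _ _ _) he) (Exec.assign _ _ _), ?_⟩
        · simp [Expr.cost]
          omega
        · have hfr := State.frame_setReg d d
            (Expr.eval s₃ (.add (.reg (2 * d + 3)) (.const 1))) s₃ le_rfl
          refine ⟨?_, hfr.reg_zero.trans (h0'.trans h0), ?_, ?_, fun j hj => ?_⟩
          · rw [hfr.vars, hv', State.vars_setReg, hv, List.range_succ, List.foldl_append]
            rfl
          · rw [hfr.2 1 fun j _ => by omega, h1', h1]
          · rw [State.reg_setReg_self]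
            simp only [Expr.eval]
            rw [hf' d (by omega), State.reg_setReg_of_ne _ _ (by omega), hi]
          · rw [hfr.reg_temp hj, hf' j (by omega), State.reg_setReg_of_ne _ _ (by omega), hf j hj])
      (s.setReg (2 * d + 3) 0)
      (by
        have hfr := State.frame_setReg d d 0 s le_rfl
        refine ⟨by simpa using hfr.vars, hfr.reg_zero, hfr.2 1 fun j _ => by omega, ?_,
          fun j hj => hfr.reg_temp hj⟩
        rw [State.reg_setReg_self])
    refine ⟨_, ?_, _, Exec.seq (Exec.assign _ (.const 0) _) he, hv, h0, h1, hf⟩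
    simp [Expr.cost]
    omega

/-! ### Independent sets of maximum weight by simplicial elimination -/

section Elimination

variable {V : Type*} (c : V → V → Prop)

/-- No two distinct elements of `I` are in conflict. -/
def IsConflictFree (I : Finset V) : Prop :=
  ∀ p ∈ I, ∀ q ∈ I, p ≠ q → ¬ c p q

open Classical in
/-- The largest weight of a conflict-free set. -/
noncomputable def maxWeight [Fintype V] (w : V → ℕ) : ℕ :=
  (Finset.univ.filter (IsConflictFree c)).sup fun I => ∑ p ∈ I, w p

/-- The element `p` has positive weight, and the elements of positive weight in conflict with `p`
are pairwise in conflict. -/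
def IsSimplicial (w : V → ℕ) (p : V) : Prop :=
  w p ≠ 0 ∧ ∀ q r, w q ≠ 0 → w r ≠ 0 → c p q → c p r → c q r

open Classical in
/-- The weight of `p` if `p` is simplicial, and `0` otherwise. -/
noncomputable def gain (w : V → ℕ) (p : V) : ℕ :=
  if IsSimplicial c w p then w p else 0

open Classical in
/-- Subtract the gain at `p` from the weights of all elements in conflict with `p`, and add it
to the total. -/
noncomputable def eliminate (x : (V → ℕ) × ℕ) (p : V) : (V → ℕ) × ℕ :=
  (fun q => x.1 q - if c p q then gain c x.1 p else 0, x.2 + gain c x.1 p)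

variable {c}

theorem IsConflictFree.sum_le_maxWeight [Fintype V] {I : Finset V} (h : IsConflictFree c I) (w : V → ℕ) :
    ∑ p ∈ I, w p ≤ maxWeight c w := by
  classical
  exact Finset.le_sup (f := fun I => ∑ p ∈ I, w p) (by simpa using h)

theorem maxWeight_le [Fintype V] {w : V → ℕ} {m : ℕ} (h : ∀ I, IsConflictFree c I → ∑ p ∈ I, w p ≤ m) :
    maxWeight c w ≤ m := by
  classical
  exact Finset.sup_le fun I hI => h I (by simpa using hI)

theorem IsConflictFree.subset {I J : Finset V} (h : IsConflictFree c I) (hJ : J ⊆ I) :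
    IsConflictFree c J :=
  fun p hp q hq => h p (hJ hp) q (hJ hq)

theorem maxWeight_zero [Fintype V] : maxWeight c (0 : V → ℕ) = 0 :=
  Nat.le_zero.1 (maxWeight_le fun I _ => by simp)

/-- A conflict-free set loses at most `w p` in passing to `w'`, and an optimal set for `w'` can be
arranged to gain at least `w p` in passing back: it either already meets the conflicts of `p` or can
be enlarged by `p`. -/
theorem maxWeight_eq_of_isSimplicial [Fintype V] (hrefl : ∀ p, c p p) (hsymm : ∀ p q, c p q → c q p)
    {w w' : V → ℕ} {p : V} (hp : IsSimplicial c w p) (h1 : ∀ q, c p q → w' q = w q - w p)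
    (h2 : ∀ q, ¬ c p q → w' q = w q) : maxWeight c w = w p + maxWeight c w' := by
  classical
  apply le_antisymm
  · refine maxWeight_le fun I hI => ?_
    have hle := hI.sum_le_maxWeight w'
    suffices ∑ q ∈ I, w q ≤ w p + ∑ q ∈ I, w' q by omega
    -- Simpliciality: positive elements in conflict with `p` are pairwise in conflict, so `I` has at
    -- most one.
    have hcard : (I.filter fun q => c p q ∧ w q ≠ 0).card ≤ 1 := by
      refine Finset.card_le_one.2 fun a ha b hb => ?_
      simp only [Finset.mem_filter] at ha hb
      by_contra hab
      exact hI a ha.1 b hb.1 hab (hp.2 a b ha.2.2 hb.2.2 ha.2.1 hb.2.1)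
    calc ∑ q ∈ I, w q ≤ ∑ q ∈ I, ((if c p q ∧ w q ≠ 0 then w p else 0) + w' q) := by
          refine Finset.sum_le_sum fun q _ => ?_
          by_cases hc : c p q
          · rw [h1 q hc]
            split_ifs <;> grind
          · rw [h2 q hc]
            omega
      _ = (I.filter fun q => c p q ∧ w q ≠ 0).card * w p + ∑ q ∈ I, w' q := by
          rw [Finset.sum_add_distrib, ← Finset.sum_filter, Finset.sum_const, smul_eq_mul]
      _ ≤ w p + ∑ q ∈ I, w' q := by
          have := Nat.mul_le_mul_right (w p) hcard
          omega
  · have hle : ∀ q, w' q ≤ w q := fun q => by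
      by_cases hc : c p q
      · rw [h1 q hc]
        omega
      · rw [h2 q hc]
    suffices H : maxWeight c w' ≤ maxWeight c w - w p by
      have := (show IsConflictFree c {p} by
        intro a ha b hb hab
        simp only [Finset.mem_singleton] at ha hb
        exact absurd (ha.trans hb.symm) hab).sum_le_maxWeight w
      rw [Finset.sum_singleton] at this
      omega
    refine maxWeight_le fun I hI => ?_
    -- Without the elements of new weight 0, truncation plays no role: in `J`, a conflict of `p`
    -- lost exactly `w p`.
    set J := I.filter fun q => w' q ≠ 0 with hJ
    have hJc : IsConflictFree c J := hI.subset (Finset.filter_subset _ _)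
    have hsum : ∑ q ∈ I, w' q = ∑ q ∈ J, w' q := (Finset.sum_filter_ne_zero I).symm
    rw [hsum]
    by_cases hex : ∃ q ∈ J, c p q
    · obtain ⟨q, hq, hpq⟩ := hex
      have h3 : w q = w' q + w p := by
        have := (Finset.mem_filter.1 hq).2
        have := h1 q hpq
        omega
      have h4 : ∑ q ∈ J.erase q, w' q ≤ ∑ q ∈ J.erase q, w q :=
        Finset.sum_le_sum fun q _ => hle q
      have h5 := Finset.add_sum_erase J w hq
      have h6 := Finset.add_sum_erase J w' hq
      have h7 := hJc.sum_le_maxWeight w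
      omega
    · push Not at hex
      have hpJ : p ∉ J := fun h => hex p h (hrefl p)
      have hins : IsConflictFree c (insert p J) := by
        intro a ha b hb hab hc
        rcases Finset.mem_insert.1 ha with rfl | ha' <;> rcases Finset.mem_insert.1 hb with rfl | hb'
        · exact hab rfl
        · exact hex b hb' hc
        · exact hex a ha' (hsymm _ _ hc)
        · exact hJc a ha' b hb' hab hc
      have h7 := hins.sum_le_maxWeight w
      rw [Finset.sum_insert hpJ] at h7
      have h4 : ∑ q ∈ J, w' q ≤ ∑ q ∈ J, w q := Finset.sum_le_sum fun q _ => hle q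
      omega

/-- The total plus the remaining optimum is invariant; at a non-simplicial `p` the gain is 0 and
nothing changes. -/
theorem eliminate_potential [Fintype V] (hrefl : ∀ p, c p p) (hsymm : ∀ p q, c p q → c q p)
    (x : (V → ℕ) × ℕ) (p : V) :
    (eliminate c x p).2 + maxWeight c (eliminate c x p).1 = x.2 + maxWeight c x.1 := by
  by_cases hp : IsSimplicial c x.1 p
  · rw [maxWeight_eq_of_isSimplicial (w' := (eliminate c x p).1) hrefl hsymm hp
      (fun q hq => by simp [eliminate, gain, hq, hp]) (fun q hq => by simp [eliminate, hq])]
    simp [eliminate, gain, hp, add_assoc]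
  · simp [eliminate, gain, hp]

theorem foldl_eliminate_potential [Fintype V] (hrefl : ∀ p, c p p) (hsymm : ∀ p q, c p q → c q p)
    (L : List V) (x : (V → ℕ) × ℕ) :
    (L.foldl (eliminate c) x).2 + maxWeight c (L.foldl (eliminate c) x).1 =
      x.2 + maxWeight c x.1 := by
  induction L generalizing x with
  | nil => rfl
  | cons p L ih => rw [List.foldl_cons, ih, eliminate_potential hrefl hsymm]

theorem eliminate_le (x : (V → ℕ) × ℕ) (p q : V) : (eliminate c x p).1 q ≤ x.1 q := by
  simp [eliminate]

theorem foldl_eliminate_le (L : List V) (x : (V → ℕ) × ℕ) (q : V) :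
    (L.foldl (eliminate c) x).1 q ≤ x.1 q := by
  induction L generalizing x with
  | nil => rfl
  | cons p L ih => exact (ih _).trans (eliminate_le x p q)

/-- Weights only decrease, so a simplicial element stays simplicial while its weight is positive.
When its turn comes it is in conflict with itself and loses its whole weight. -/
theorem foldl_eliminate_eq_zero (hrefl : ∀ p, c p p) (L : List V) (x : (V → ℕ) × ℕ) {p : V}
    (hpL : p ∈ L) (hp : IsSimplicial c x.1 p) : (L.foldl (eliminate c) x).1 p = 0 := by
  induction L generalizing x with
  | nil => simp at hpL
  | cons q L ih =>
    rw [List.foldl_cons]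
    by_cases h0 : (eliminate c x q).1 p = 0
    · exact Nat.le_zero.1 (h0 ▸ foldl_eliminate_le L (eliminate c x q) p)
    rcases List.mem_cons.1 hpL with rfl | hpL
    · exact absurd (by simp [eliminate, gain, hp, hrefl p]) h0
    · refine ih _ hpL ⟨h0, fun a b ha hb => hp.2 a b ?_ ?_⟩
      · have := eliminate_le (c := c) x q a
        omega
      · have := eliminate_le (c := c) x q b
        omega

/-- Each pass clears a positive weight while one is left, so `Fintype.card V` passes clear all. The
potential then consists of the total alone. -/
theorem iterate_foldl_eliminate [Fintype V] (hrefl : ∀ p, c p p) (hsymm : ∀ p q, c p q → c q p)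
    {w : V → ℕ} (hex : ∀ w' ≤ w, w' ≠ 0 → ∃ p, IsSimplicial c w' p) {L : List V}
    (hL : ∀ p, p ∈ L) {m : ℕ} (hm : Fintype.card V ≤ m) :
    ((fun x => L.foldl (eliminate c) x)^[m] (w, 0)).2 = maxWeight c w := by
  classical
  set F : (V → ℕ) × ℕ → (V → ℕ) × ℕ := fun x => L.foldl (eliminate c) x with hF
  have key : ∀ k, (F^[k] (w, 0)).1 ≤ w ∧
      (F^[k] (w, 0)).2 + maxWeight c (F^[k] (w, 0)).1 = maxWeight c w ∧
      (Finset.univ.filter fun p => (F^[k] (w, 0)).1 p ≠ 0).card ≤ Fintype.card V - k := by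
    intro k
    induction k with
    | zero => exact ⟨le_rfl, by simp, by simpa using Finset.card_le_univ _⟩
    | succ k ih =>
      rw [Function.iterate_succ_apply']
      set x := F^[k] (w, 0) with hx
      obtain ⟨h1, h2, h3⟩ := ih
      refine ⟨fun p => (foldl_eliminate_le L x p).trans (h1 p), ?_, ?_⟩
      · rw [← h2]
        exact foldl_eliminate_potential hrefl hsymm L x
      · have hsub : (Finset.univ.filter fun p => (F x).1 p ≠ 0) ⊆
            Finset.univ.filter fun p => x.1 p ≠ 0 := fun p hp => by
          have := foldl_eliminate_le (c := c) L x p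
          simp only [Finset.mem_filter, Finset.mem_univ, true_and, hF] at hp ⊢
          omega
        by_cases h0 : x.1 = 0
        · have : (Finset.univ.filter fun p => x.1 p ≠ 0) = ∅ := by simp [h0]
          rw [this, Finset.subset_empty] at hsub
          simp [hsub]
        · obtain ⟨p, hp⟩ := hex _ h1 h0
          have : (Finset.univ.filter fun p => (F x).1 p ≠ 0).card <
              (Finset.univ.filter fun p => x.1 p ≠ 0).card := by
            refine Finset.card_lt_card ⟨hsub, fun h => ?_⟩
            have := h (Finset.mem_filter.2 ⟨Finset.mem_univ p, hp.1⟩)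
            exact (Finset.mem_filter.1 this).2 (foldl_eliminate_eq_zero hrefl L x (hL p) hp)
          omega
  obtain ⟨-, h2, h3⟩ := key m
  have h0 : (F^[m] (w, 0)).1 = 0 := by
    funext p
    have : (Finset.univ.filter fun p => (F^[m] (w, 0)).1 p ≠ 0).card = 0 := by omega
    rw [Finset.card_eq_zero, Finset.filter_eq_empty_iff] at this
    simpa using this (Finset.mem_univ p)
  rw [h0, maxWeight_zero] at h2
  simpa using h2

end Elimination

/-! ### Separated-clusters of interval graphs as conflict-free sets of cliques -/

section Graph

variable {V : Type*} (G : SimpleGraph V)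

/-- The vertices `u` and `v` are equal or adjacent. -/
def Near (u v : V) : Prop := u = v ∨ G.Adj u v

/-- The vertex `x` is in the closed neighbourhood of the pair `p`. -/
def Covers (p : V × V) (x : V) : Prop := Near G p.1 x ∨ Near G p.2 x

/-- The closed neighbourhoods of two pairs meet. -/
def Conflict (p q : V × V) : Prop := ∃ x, Covers G p x ∧ Covers G q x

/-- The closed neighbourhood of `z` is contained in that of the pair `p`. -/
def Inside (p : V × V) (z : V) : Prop := ∀ x, Near G z x → Covers G p x

/-- The elements of `C` are pairwise adjacent. -/
def IsNearClique (C : Finset V) : Prop := ∀ z ∈ C, ∀ z' ∈ C, Near G z z'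

open Classical in
/-- The vertices inside `p` in the closed neighbourhoods of both `x` and `y`. -/
noncomputable def commonInside [Fintype V] (p : V × V) (x y : V) : Finset V :=
  Finset.univ.filter fun z => Inside G p z ∧ Near G x z ∧ Near G y z

open Classical in
/-- The largest size of a clique of the form `commonInside G p x y`, if the vertices of `p` are equal
or adjacent, and `0` otherwise. -/
noncomputable def cliqueWeight [Fintype V] (p : V × V) : ℕ :=
  if Near G p.1 p.2 then
    (Finset.univ : Finset (V × V)).sup fun xy =>
      if IsNearClique G (commonInside G p xy.1 xy.2) then (commonInside G p xy.1 xy.2).card else 0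
  else 0

variable {G}

theorem Near.refl (u : V) : Near G u u := Or.inl rfl

theorem Near.symm {u v : V} (h : Near G u v) : Near G v u :=
  h.imp Eq.symm fun h => h.symm

theorem Conflict.refl (p : V × V) : Conflict G p p :=
  ⟨p.1, Or.inl (Near.refl _), Or.inl (Near.refl _)⟩

theorem Conflict.symm {p q : V × V} (h : Conflict G p q) : Conflict G q p :=
  h.imp fun _ h => h.symm

theorem dist_eq_two_iff {u v : V} :
    G.dist u v = 2 ↔ ¬ Near G u v ∧ ∃ x, Near G u x ∧ Near G v x := by
  constructor
  · intro h
    have hn : ¬ Near G u v := by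
      rintro (rfl | hadj)
      · simp at h
      · rw [SimpleGraph.dist_eq_one_iff_adj.2 hadj] at h
        omega
    refine ⟨hn, ?_⟩
    obtain ⟨p, hp⟩ := SimpleGraph.exists_walk_of_dist_ne_zero (G := G) (u := u) (v := v) (by omega)
    rw [h] at hp
    match p, hp with
    | .cons (v := x) h1 (.cons h2 .nil), _ => exact ⟨x, Or.inr h1, Or.inr h2.symm⟩
  · rintro ⟨hn, x, hux, hvx⟩
    have hux' : G.Adj u x := hux.resolve_left fun h => hn (h ▸ hvx.symm)
    have hvx' : G.Adj v x := hvx.resolve_left fun h => hn (h ▸ hux)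
    have hle := SimpleGraph.dist_le (.cons hux' (.cons hvx'.symm .nil) : G.Walk u v)
    -- Reachability is needed for the lower bound, as `dist` is 0 between different components.
    have hlt := (hux'.reachable.trans hvx'.symm.reachable).one_lt_dist_of_ne_of_not_adj
      (fun h => hn (Or.inl h)) (fun h => hn (Or.inr h))
    simp only [SimpleGraph.Walk.length_cons, SimpleGraph.Walk.length_nil] at hle
    omega

theorem exists_clique_card_eq_cliqueWeight [Fintype V] (p : V × V) :
    ∃ C : Finset V, IsNearClique G C ∧ (∀ z ∈ C, Inside G p z) ∧ C.card = cliqueWeight G p := by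
  classical
  by_cases h0 : cliqueWeight G p = 0
  -- Weight 0 also covers pairs that are not near and pairs without a suitable clique.
  · exact ⟨∅, by simp [IsNearClique], by simp, by simp [h0]⟩
  have hn : Near G p.1 p.2 := by
    by_contra hn
    exact h0 (by simp [cliqueWeight, hn])
  obtain ⟨xy, -, hxy⟩ := Finset.exists_mem_eq_sup (Finset.univ : Finset (V × V))
    ⟨p, Finset.mem_univ p⟩ (fun xy =>
      if IsNearClique G (commonInside G p xy.1 xy.2) then (commonInside G p xy.1 xy.2).card else 0)
  have hw : cliqueWeight G p =
      if IsNearClique G (commonInside G p xy.1 xy.2) then (commonInside G p xy.1 xy.2).card else 0 := by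
    rw [cliqueWeight, if_pos hn, hxy]
  have hc : IsNearClique G (commonInside G p xy.1 xy.2) := by
    by_contra hc
    exact h0 (by rw [hw, if_neg hc])
  exact ⟨_, hc, fun z hz => (Finset.mem_filter.1 hz).2.1, by rw [hw, if_pos hc]⟩

/-- The cliques of a conflict-free set of pairs form a separated-cluster. -/
theorem exists_isSeparatedCluster_of_isConflictFree [Fintype V] {I : Finset (V × V)}
    (hI : IsConflictFree (Conflict G) I) :
    ∃ S : Finset V, IsSeparatedCluster G S ∧ S.card = ∑ p ∈ I, cliqueWeight G p := by
  classical
  choose C hC hin hcard using fun p => exists_clique_card_eq_cliqueWeight (G := G) p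
  refine ⟨I.biUnion C, ?_, ?_⟩
  · intro u hu v hv h
    obtain ⟨p, hp, hup⟩ := Finset.mem_biUnion.1 hu
    obtain ⟨q, hq, hvq⟩ := Finset.mem_biUnion.1 hv
    obtain ⟨hn, x, hux, hvx⟩ := dist_eq_two_iff.1 h
    by_cases hpq : p = q
    · subst hpq
      exact hn (hC p u hup v hvq)
    -- The common neighbour `x` lies in the closed neighbourhoods of both pairs because `u` and `v`
    -- are inside them.
    · exact hI p hp q hq hpq ⟨x, hin p u hup x hux, hin q v hvq x hvx⟩
  · rw [Finset.card_biUnion]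
    · exact Finset.sum_congr rfl fun p _ => hcard p
    · intro p hp q hq hpq
      rw [Function.onFun, Finset.disjoint_left]
      intro z hzp hzq
      exact hI p hp q hq hpq ⟨z, hin p z hzp z (Near.refl z), hin q z hzq z (Near.refl z)⟩

/-- An assignment of intervals such that `Near` is intersection. -/
theorem IsIntervalGraph.exists_near_iff (h : IsIntervalGraph G) :
    ∃ l r : V → ℝ, (∀ v, l v ≤ r v) ∧ ∀ u v, Near G u v ↔ l u ≤ r v ∧ l v ≤ r u := by
  obtain ⟨l, r, hlr, h⟩ := h
  refine ⟨l, r, hlr, fun u v => ?_⟩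
  by_cases huv : u = v
  · subst huv
    exact ⟨fun _ => ⟨hlr u, hlr u⟩, fun _ => Near.refl u⟩
  · have : Near G u v ↔ G.Adj u v := by simp [Near, huv]
    rw [this, h u v huv]
    constructor
    · rintro ⟨x, hx, hx'⟩
      exact ⟨hx.1.trans hx'.2, hx'.1.trans hx.2⟩
    · rintro ⟨h1, h2⟩
      exact ⟨max (l u) (l v), ⟨le_max_left _ _, max_le (hlr u) h2⟩,
        ⟨le_max_right _ _, max_le h1 (hlr v)⟩⟩

/-- The two intervals of `p` intersect, so their union is a single interval, and being covered means
meeting it. -/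
theorem covers_iff {l r : V → ℝ} (hlr : ∀ v, l v ≤ r v)
    (h : ∀ u v, Near G u v ↔ l u ≤ r v ∧ l v ≤ r u) {p : V × V} (hp : Near G p.1 p.2) (x : V) :
    Covers G p x ↔ l x ≤ max (r p.1) (r p.2) ∧ min (l p.1) (l p.2) ≤ r x := by
  rw [h] at hp
  have h1 := hlr p.1
  have h2 := hlr p.2
  have h3 := hlr x
  rw [Covers, h, h, le_max_iff, min_le_iff]
  constructor
  · rintro (⟨ha, hb⟩ | ⟨ha, hb⟩)
    · exact ⟨Or.inl hb, Or.inl ha⟩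
    · exact ⟨Or.inr hb, Or.inr ha⟩
  · rintro ⟨ha | ha, hb | hb⟩
    · exact Or.inl ⟨hb, ha⟩
    · by_cases hc : l p.1 ≤ r x
      · exact Or.inl ⟨hc, ha⟩
      · exact Or.inr ⟨hb, by linarith [hp.1, not_le.1 hc]⟩
    · by_cases hc : l p.2 ≤ r x
      · exact Or.inr ⟨hc, ha⟩
      · exact Or.inl ⟨hb, by linarith [hp.2, not_le.1 hc]⟩
    · exact Or.inr ⟨hb, ha⟩

/-- Among finitely many pairs of adjacent vertices of an interval graph, one whose closed
neighbourhood ends first is simplicial. -/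
theorem IsIntervalGraph.exists_isSimplicial [Fintype V] (h : IsIntervalGraph G) {w : V × V → ℕ}
    (hw : ∀ p, w p ≠ 0 → Near G p.1 p.2) (hw0 : w ≠ 0) :
    ∃ p, IsSimplicial (Conflict G) w p := by
  classical
  obtain ⟨l, r, hlr, h⟩ := h.exists_near_iff
  -- The end of a closed neighbourhood is measured by the covered vertex `z p` that ends last; `p`
  -- will minimise it.
  have hlast : ∀ p : V × V, ∃ z, Covers G p z ∧ ∀ x, Covers G p x → r x ≤ r z := fun p => by
    obtain ⟨z, hz, hmax⟩ := Finset.exists_max_image (Finset.univ.filter (Covers G p)) r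
      ⟨p.1, Finset.mem_filter.2 ⟨Finset.mem_univ _, Or.inl (Near.refl _)⟩⟩
    exact ⟨z, by simpa using hz, fun x hx => hmax x (by simpa using hx)⟩
  choose z hz hmax using hlast
  obtain ⟨p₀, hp₀⟩ := Function.ne_iff.1 hw0
  obtain ⟨p, hp, hmin⟩ := Finset.exists_min_image (Finset.univ.filter fun p => w p ≠ 0)
    (fun p => r (z p)) ⟨p₀, by simpa using hp₀⟩
  simp only [Finset.mem_filter, Finset.mem_univ, true_and] at hp hmin
  refine ⟨p, hp, ?_⟩
  suffices H : ∀ q s, w q ≠ 0 → w s ≠ 0 → Conflict G p s →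
      max (r q.1) (r q.2) ≤ max (r s.1) (r s.2) → Conflict G q s by
    intro q s hq hs hpq hps
    rcases le_total (max (r q.1) (r q.2)) (max (r s.1) (r s.2)) with hle | hle
    · exact H q s hq hs hps hle
    · exact (H s q hs hq hpq hle).symm
  intro q s hq hs hps hle
  obtain ⟨x, hpx, hsx⟩ := hps
  -- The interval of `z q` meets the union for `s`: it starts before the union for `q` ends, hence
  -- before that for `s` does, and by the choice of `p` it ends no earlier than `x`, which `s`
  -- covers.
  refine ⟨z q, hz q, (covers_iff hlr h (hw s hs) _).2 ⟨?_, ?_⟩⟩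
  · exact ((covers_iff hlr h (hw q hq) _).1 (hz q)).1.trans hle
  · exact ((covers_iff hlr h (hw s hs) _).1 hsx).2.trans ((hmax p x hpx).trans (hmin q hq))

/-- In an interval graph, the size of a clique is at most the weight of some pair of its vertices. -/
theorem IsIntervalGraph.exists_card_le_cliqueWeight [Fintype V] (h : IsIntervalGraph G)
    {C : Finset V} (hC : IsNearClique G C) (hne : C.Nonempty) :
    ∃ p : V × V, p.1 ∈ C ∧ p.2 ∈ C ∧ C.card ≤ cliqueWeight G p := by
  classical
  obtain ⟨l, r, hlr, h⟩ := h.exists_near_iff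
  -- The intervals of `u` and `v` together span all intervals of `C`.
  obtain ⟨u, hu, humin⟩ := C.exists_min_image l hne
  obtain ⟨v, hv, hvmax⟩ := C.exists_max_image r hne
  refine ⟨(u, v), hu, hv, ?_⟩
  have hin : ∀ z ∈ C, Inside G (u, v) z := fun z hz x hx => by
    rw [covers_iff hlr h (hC u hu v hv)]
    rw [h] at hx
    exact ⟨le_max_of_le_right (hx.2.trans (hvmax z hz)), min_le_of_left_le ((humin z hz).trans hx.1)⟩
  -- Only a maximal clique inside the pair is certain to be of the form `commonInside`, so `C` is
  -- enlarged.
  obtain ⟨D, hD, hDmax⟩ := (Finset.univ.filter fun D : Finset V =>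
    C ⊆ D ∧ IsNearClique G D ∧ ∀ z ∈ D, Inside G (u, v) z).exists_max_image Finset.card
    ⟨C, by simpa using ⟨hC, hin⟩⟩
  simp only [Finset.mem_filter, Finset.mem_univ, true_and] at hD hDmax
  obtain ⟨hCD, hDc, hDin⟩ := hD
  have hDne := hne.mono hCD
  -- An interval that meets those of `x`, ending first, and `y`, starting last, meets every interval
  -- of `D`. By maximality its vertex lies in `D` if it is inside the pair.
  obtain ⟨x, hx, hxmin⟩ := D.exists_min_image r hDne
  obtain ⟨y, hy, hymax⟩ := D.exists_max_image l hDne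
  have hDeq : commonInside G (u, v) x y = D := by
    ext z
    simp only [commonInside, Finset.mem_filter, Finset.mem_univ, true_and]
    refine ⟨fun ⟨hz, hxz, hyz⟩ => ?_, fun hz => ⟨hDin z hz, hDc x hx z hz, hDc y hy z hz⟩⟩
    by_contra hzD
    have hnear : ∀ a ∈ D, Near G z a := fun a ha => by
      rw [h] at hxz hyz ⊢
      exact ⟨hxz.2.trans (hxmin a ha), (hymax a ha).trans hyz.1⟩
    have := hDmax (insert z D) ⟨hCD.trans (Finset.subset_insert _ _), by
      intro a ha b hb
      rcases Finset.mem_insert.1 ha with rfl | ha' <;> rcases Finset.mem_insert.1 hb with rfl | hb'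
      · exact Near.refl _
      · exact hnear b hb'
      · exact (hnear a ha').symm
      · exact hDc a ha' b hb', by
      intro a ha
      rcases Finset.mem_insert.1 ha with rfl | ha
      · exact hz
      · exact hDin a ha⟩
    rw [Finset.card_insert_of_notMem hzD] at this
    omega
  have hle := Finset.le_sup (f := fun xy : V × V =>
    if IsNearClique G (commonInside G (u, v) xy.1 xy.2) then
      (commonInside G (u, v) xy.1 xy.2).card else 0) (Finset.mem_univ (x, y))
  rw [cliqueWeight, if_pos (hC u hu v hv)]
  refine le_trans ?_ hle
  simp only [hDeq, if_pos hDc]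
  exact Finset.card_le_card hCD

/-- In an interval graph, the cliques of a separated-cluster give a conflict-free set of pairs. -/
theorem IsIntervalGraph.card_le_maxWeight [Fintype V] (h : IsIntervalGraph G) {S : Finset V}
    (hS : IsSeparatedCluster G S) : S.card ≤ maxWeight (Conflict G) (cliqueWeight G) := by
  classical
  -- Nearness is an equivalence relation on `S`, with classes `K s`. The common neighbour `x` need
  -- not lie in `S`.
  have htrans : ∀ a ∈ S, ∀ b ∈ S, ∀ x, Near G a x → Near G b x → Near G a b := by
    intro a ha b hb x hax hbx
    by_contra hab
    exact hS a ha b hb (dist_eq_two_iff.2 ⟨hab, x, hax, hbx⟩)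
  let K : V → Finset V := fun s => S.filter (Near G s)
  have hK : ∀ s ∈ S, IsNearClique G (K s) := by
    intro s hs a ha b hb
    simp only [K, Finset.mem_filter] at ha hb
    exact htrans a ha.1 b hb.1 s ha.2.symm hb.2.symm
  have hKeq : ∀ s ∈ S, ∀ t ∈ S, Near G s t → K s = K t := by
    intro s hs t ht hst
    ext a
    simp only [K, Finset.mem_filter]
    exact ⟨fun ⟨ha, hsa⟩ => ⟨ha, htrans t ht a ha s hst.symm hsa.symm⟩,
      fun ⟨ha, hta⟩ => ⟨ha, htrans s hs a ha t hst hta.symm⟩⟩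
  rcases S.eq_empty_or_nonempty with rfl | ⟨s₀, -⟩
  · simp
  have : Nonempty (V × V) := ⟨(s₀, s₀)⟩
  choose! f hf1 hf2 hf3 using fun (C : Finset V) (hC : IsNearClique G C) (hne : C.Nonempty) =>
    h.exists_card_le_cliqueWeight hC hne
  have hne : ∀ s ∈ S, (K s).Nonempty := fun s hs =>
    ⟨s, Finset.mem_filter.2 ⟨hs, Near.refl s⟩⟩
  have hcov : ∀ s ∈ S, ∀ x, Covers G (f (K s)) x → ∃ a ∈ S, Near G s a ∧ Near G a x := by
    rintro s hs x (hx | hx)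
    · have := Finset.mem_filter.1 (hf1 _ (hK s hs) (hne s hs))
      exact ⟨_, this.1, this.2, hx⟩
    · have := Finset.mem_filter.1 (hf2 _ (hK s hs) (hne s hs))
      exact ⟨_, this.1, this.2, hx⟩
  have hfree : IsConflictFree (Conflict G) (S.image fun s => f (K s)) := by
    intro p hp q hq hpq hc
    obtain ⟨s, hs, rfl⟩ := Finset.mem_image.1 hp
    obtain ⟨t, ht, rfl⟩ := Finset.mem_image.1 hq
    obtain ⟨x, hsx, htx⟩ := hc
    obtain ⟨a, ha, hsa, hax⟩ := hcov s hs x hsx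
    obtain ⟨b, hb, htb, hbx⟩ := hcov t ht x htx
    exact hpq (by
      simp only [hKeq s hs a ha hsa, hKeq t ht b hb htb,
        hKeq a ha b hb (htrans a ha b hb x hax hbx)])
  refine le_trans ?_ (hfree.sum_le_maxWeight _)
  -- The fibre over `f (K s)` lies in `K s`: if `t` has the same pair, its first vertex is near both
  -- `s` and `t`.
  rw [Finset.card_eq_sum_card_image (fun s => f (K s)) S]
  refine Finset.sum_le_sum fun p hp => ?_
  obtain ⟨s, hs, rfl⟩ := Finset.mem_image.1 hp
  refine (Finset.card_le_card fun t ht => ?_).trans (hf3 _ (hK s hs) (hne s hs))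
  obtain ⟨ht, hts⟩ := Finset.mem_filter.1 ht
  have h1 := Finset.mem_filter.1 (hf1 _ (hK s hs) (hne s hs))
  have h2 := Finset.mem_filter.1 (hf1 _ (hK t ht) (hne t ht))
  rw [hts] at h2
  exact Finset.mem_filter.2 ⟨ht, htrans s hs t ht _ h1.2 h2.2⟩

/-- Attainment and bound together serve both the value of the supremum and the decision problem. -/
theorem IsIntervalGraph.isGreatest_maxWeight [Fintype V] (h : IsIntervalGraph G) :
    IsGreatest {k | ∃ S : Finset V, IsSeparatedCluster G S ∧ S.card = k}
      (maxWeight (Conflict G) (cliqueWeight G)) := by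
  classical
  refine ⟨?_, fun k ⟨S, hS, hk⟩ => hk ▸ h.card_le_maxWeight hS⟩
  obtain ⟨I, hI, hsup⟩ := Finset.exists_mem_eq_sup
    (Finset.univ.filter (IsConflictFree (Conflict G)))
    ⟨∅, Finset.mem_filter.2 ⟨Finset.mem_univ _, by simp [IsConflictFree]⟩⟩
    fun I => ∑ p ∈ I, cliqueWeight G p
  rw [maxWeight, hsup]
  exact exists_isSeparatedCluster_of_isConflictFree (Finset.mem_filter.1 hI).2

end Graph

/-! ### The bounded program for the separated-cluster number -/

/-- Adjacency in `G` can be read off array `0`. -/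
def State.HoldsAdj {n : ℕ} (G : SimpleGraph (Fin n)) (m : State) : Prop :=
  ∀ u v : Fin n, m.arr 0 (n * u + v) ≠ 0 ↔ G.Adj u v

theorem State.HoldsAdj.setReg {n : ℕ} {G : SimpleGraph (Fin n)} {m : State} (h : m.HoldsAdj G)
    (x v : ℕ) : (m.setReg x v).HoldsAdj G := h

theorem pair_code_inj {n : ℕ} {i j i' j' : Fin n} (h : n * (i : ℕ) + j = n * i' + j') :
    i = i' ∧ j = j' := by
  have hi : (i : ℕ) = i' := by
    rcases lt_trichotomy (i : ℕ) i' with hlt | heq | hlt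
    · have := Nat.mul_le_mul_left n hlt
      rw [Nat.mul_succ] at this
      omega
    · exact heq
    · have := Nat.mul_le_mul_left n hlt
      rw [Nat.mul_succ] at this
      omega
  rw [hi] at h
  exact ⟨Fin.ext hi, Fin.ext (by omega)⟩

/-! ### Conflicts, clique weights and simpliciality as bounded expressions. -/

namespace BoundedExpr

/-- Conjunction. -/
def and (e f : BoundedExpr) : BoundedExpr := .ite e f (.const 0)

/-- Implication. -/
def imp (e f : BoundedExpr) : BoundedExpr := .ite e f (.const 1)

/-- Universal quantification over all vertices. -/
def all (x : ℕ) (e : BoundedExpr) : BoundedExpr :=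
  .sub (.const 1) (.sum x (.sub (.const 1) e))

variable {n : ℕ} {m : State}

/-- Nonzero means true, so addition is disjunction and a sum over all vertices is existential
quantification. -/
theorem eval_add_ne_zero {e f : BoundedExpr} :
    (add e f).eval n m ≠ 0 ↔ e.eval n m ≠ 0 ∨ f.eval n m ≠ 0 := by
  simp only [eval]
  omega

theorem eval_and_ne_zero {e f : BoundedExpr} :
    (and e f).eval n m ≠ 0 ↔ e.eval n m ≠ 0 ∧ f.eval n m ≠ 0 := by
  simp only [and, eval]
  split_ifs <;> simp_all

theorem eval_imp_ne_zero {e f : BoundedExpr} :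
    (imp e f).eval n m ≠ 0 ↔ (e.eval n m ≠ 0 → f.eval n m ≠ 0) := by
  simp only [imp, eval]
  split_ifs <;> simp_all

theorem eval_sum_ne_zero {x : ℕ} {e : BoundedExpr} :
    (sum x e).eval n m ≠ 0 ↔ ∃ i : Fin n, e.eval n (m.setReg x i) ≠ 0 := by
  simp [eval, Finset.sum_eq_zero_iff]

theorem eval_all_ne_zero {x : ℕ} {e : BoundedExpr} :
    (all x e).eval n m ≠ 0 ↔ ∀ i : Fin n, e.eval n (m.setReg x i) ≠ 0 := by
  have h := eval_sum_ne_zero (n := n) (m := m) (x := x) (e := .sub (.const 1) e)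
  have h' : (all x e).eval n m ≠ 0 ↔ ¬ (sum x (.sub (.const 1) e)).eval n m ≠ 0 := by
    rw [all, eval, eval]
    omega
  rw [h', h, not_exists]
  refine forall_congr' fun i => ?_
  simp only [eval]
  omega

/-- The position of the pair of variables `i` and `j` in the row by row order of pairs. -/
def index (i j : ℕ) : BoundedExpr := .add (.sum 7 (.var i)) (.var j)

/-- The variables `i` and `j` are equal or adjacent. -/
def near (i j : ℕ) : BoundedExpr :=
  .add (.sub (.const 1) (.add (.sub (.var i) (.var j)) (.sub (.var j) (.var i))))
    (.read 0 (index i j))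

/-- The pair `(i, j)` covers `k`. -/
def covers (i j k : ℕ) : BoundedExpr := .add (near i k) (near j k)

/-- The pairs `(i, j)` and `(k, l)` are in conflict. -/
def conflict (i j k l : ℕ) : BoundedExpr := .sum 6 (and (covers i j 6) (covers k l 6))

/-- The vertex `k` is inside the pair `(i, j)`. -/
def inside (i j k : ℕ) : BoundedExpr := all 15 (imp (near k 15) (covers i j 15))

/-- The vertex `k` is inside the pair `(0, 1)` and near to `11` and `12`. -/
def inCommon (k : ℕ) : BoundedExpr := and (inside 0 1 k) (and (near 11 k) (near 12 k))

/-- The vertices inside the pair `(0, 1)` and near to `11` and `12` form a clique. -/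
def commonClique : BoundedExpr :=
  all 13 (all 14 (imp (inCommon 13) (imp (inCommon 14) (near 13 14))))

/-- The number of vertices inside the pair `(0, 1)` and near to `11` and `12`. -/
def commonCard : BoundedExpr := .sum 13 (.ite (inCommon 13) (.const 1) (.const 0))

/-- The clique weight of the pair `(0, 1)`. -/
def weight : BoundedExpr :=
  .ite (near 0 1)
    (.sum 10 (.ite (.sum 11 (.sum 12 (and commonClique (.sub commonCard (.var 10)))))
      (.const 1) (.const 0)))
    (.const 0)

/-- The entry of array `1` at the pair `(i, j)`. -/
def entry (i j : ℕ) : BoundedExpr := .read 1 (index i j)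

/-- The pair `(0, 1)` is simplicial for the weights in array `1`. -/
def simplicial : BoundedExpr :=
  and (entry 0 1) (all 2 (all 3 (all 4 (all 5 (imp (entry 2 3) (imp (entry 4 5)
    (imp (conflict 0 1 2 3) (imp (conflict 0 1 4 5) (conflict 2 3 4 5)))))))))

variable {G : SimpleGraph (Fin n)}

/-- The product is a sum of n copies of variable `i`, since the machine cannot multiply. Variable 7
is bound by that sum and must differ from `i`; similar conditions below prevent capture by the other
bound variables. -/
theorem eval_index {i j : ℕ} {u v : Fin n} (hi : i ≠ 7) (hu : m.reg i = u) (hv : m.reg j = v) :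
    (index i j).eval n m = n * u + v := by
  simp [index, eval, State.setReg, Function.update_of_ne hi, hu, hv]

theorem eval_near (hG : m.HoldsAdj G) {i j : ℕ} {u v : Fin n} (hi : i ≠ 7) (hu : m.reg i = u)
    (hv : m.reg j = v) : (near i j).eval n m ≠ 0 ↔ Near G u v := by
  rw [near, eval_add_ne_zero, Near, Fin.ext_iff]
  refine or_congr ?_ ?_
  · simp only [eval, hu, hv]
    omega
  · rw [eval, eval_index hi hu hv]
    exact hG u v

theorem eval_covers (hG : m.HoldsAdj G) {i j k : ℕ} {u v x : Fin n} (hi : i ≠ 7) (hj : j ≠ 7)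
    (hu : m.reg i = u) (hv : m.reg j = v) (hx : m.reg k = x) :
    (covers i j k).eval n m ≠ 0 ↔ Covers G (u, v) x := by
  rw [covers, eval_add_ne_zero, eval_near hG hi hu hx, eval_near hG hj hv hx, Covers]

theorem eval_conflict (hG : m.HoldsAdj G) {i j k l : ℕ} {p q : Fin n × Fin n}
    (hi : i ≠ 7 ∧ i ≠ 6) (hj : j ≠ 7 ∧ j ≠ 6) (hk : k ≠ 7 ∧ k ≠ 6) (hl : l ≠ 7 ∧ l ≠ 6)
    (h1 : m.reg i = p.1) (h2 : m.reg j = p.2) (h3 : m.reg k = q.1) (h4 : m.reg l = q.2) :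
    (conflict i j k l).eval n m ≠ 0 ↔ Conflict G p q := by
  rw [conflict, eval_sum_ne_zero, Conflict]
  refine exists_congr fun x => ?_
  rw [eval_and_ne_zero]
  refine and_congr ?_ ?_
  · exact eval_covers (hG.setReg _ _) hi.1 hj.1 (by rw [State.reg_setReg_of_ne _ _ hi.2, h1])
      (by rw [State.reg_setReg_of_ne _ _ hj.2, h2]) (State.reg_setReg_self _ _ _)
  · exact eval_covers (hG.setReg _ _) hk.1 hl.1 (by rw [State.reg_setReg_of_ne _ _ hk.2, h3])
      (by rw [State.reg_setReg_of_ne _ _ hl.2, h4]) (State.reg_setReg_self _ _ _)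

theorem eval_inside (hG : m.HoldsAdj G) {i j k : ℕ} {p : Fin n × Fin n} {z : Fin n}
    (hi : i ≠ 7 ∧ i ≠ 15) (hj : j ≠ 7 ∧ j ≠ 15) (hk : k ≠ 7 ∧ k ≠ 15)
    (h1 : m.reg i = p.1) (h2 : m.reg j = p.2) (h3 : m.reg k = z) :
    (inside i j k).eval n m ≠ 0 ↔ Inside G p z := by
  rw [inside, eval_all_ne_zero, Inside]
  refine forall_congr' fun x => ?_
  rw [eval_imp_ne_zero]
  refine imp_congr ?_ ?_
  · exact eval_near (hG.setReg _ _) hk.1 (by rw [State.reg_setReg_of_ne _ _ hk.2, h3])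
      (State.reg_setReg_self _ _ _)
  · exact eval_covers (hG.setReg _ _) hi.1 hj.1 (by rw [State.reg_setReg_of_ne _ _ hi.2, h1])
      (by rw [State.reg_setReg_of_ne _ _ hj.2, h2]) (State.reg_setReg_self _ _ _)

theorem eval_inCommon (hG : m.HoldsAdj G) {k : ℕ} {p : Fin n × Fin n} {x y z : Fin n}
    (hk : k ≠ 7 ∧ k ≠ 15) (h0 : m.reg 0 = p.1) (h1 : m.reg 1 = p.2) (hx : m.reg 11 = x)
    (hy : m.reg 12 = y) (hz : m.reg k = z) :
    (inCommon k).eval n m ≠ 0 ↔ z ∈ commonInside G p x y := by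
  rw [inCommon, eval_and_ne_zero, eval_and_ne_zero,
    eval_inside hG (by decide) (by decide) hk h0 h1 hz, eval_near hG (by decide) hx hz,
    eval_near hG (by decide) hy hz]
  simp [commonInside]

theorem eval_commonClique (hG : m.HoldsAdj G) {p : Fin n × Fin n} {x y : Fin n}
    (h0 : m.reg 0 = p.1) (h1 : m.reg 1 = p.2) (hx : m.reg 11 = x) (hy : m.reg 12 = y) :
    commonClique.eval n m ≠ 0 ↔ IsNearClique G (commonInside G p x y) := by
  have key : ∀ z z' : Fin n, (imp (inCommon 13) (imp (inCommon 14) (near 13 14))).eval n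
      ((m.setReg 13 z).setReg 14 z') ≠ 0 ↔ (z ∈ commonInside G p x y →
        z' ∈ commonInside G p x y → Near G z z') := fun z z' => by
    have hG' : ((m.setReg 13 z).setReg 14 z').HoldsAdj G := hG
    rw [eval_imp_ne_zero, eval_imp_ne_zero,
      eval_inCommon (p := p) (x := x) (y := y) (z := z) hG' (by decide) (by simpa [State.setReg])
        (by simpa [State.setReg]) (by simpa [State.setReg]) (by simpa [State.setReg])
        (by simp [State.setReg]),
      eval_inCommon (p := p) (x := x) (y := y) (z := z') hG' (by decide) (by simpa [State.setReg])
        (by simpa [State.setReg]) (by simpa [State.setReg]) (by simpa [State.setReg])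
        (by simp [State.setReg]),
      eval_near (u := z) (v := z') hG' (by decide) (by simp [State.setReg])
        (by simp [State.setReg])]
  simp only [commonClique, eval_all_ne_zero, key, IsNearClique]
  exact forall_congr' fun z => ⟨fun h hz z' hz' => h z' hz hz', fun h z' hz hz' => h hz z' hz'⟩

theorem eval_commonCard (hG : m.HoldsAdj G) {p : Fin n × Fin n} {x y : Fin n}
    (h0 : m.reg 0 = p.1) (h1 : m.reg 1 = p.2) (hx : m.reg 11 = x) (hy : m.reg 12 = y) :
    commonCard.eval n m = (commonInside G p x y).card := by
  classical
  have key : ∀ z : Fin n, (inCommon 13).eval n (m.setReg 13 z) ≠ 0 ↔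
      z ∈ commonInside G p x y := fun z =>
    eval_inCommon (hG.setReg _ _) (by decide) (by simpa [State.setReg])
      (by simpa [State.setReg]) (by simpa [State.setReg]) (by simpa [State.setReg])
      (by simp [State.setReg])
  simp only [commonCard, eval, key]
  simp

/-- The maximum `M` is computed by counting the t < n with t < `M`, that is, those exceeded by some
clique of the required form. The count is `M` because `M` ≤ n. -/
theorem eval_weight (hG : m.HoldsAdj G) {p : Fin n × Fin n} (h0 : m.reg 0 = p.1)
    (h1 : m.reg 1 = p.2) : weight.eval n m = cliqueWeight G p := by
  classical
  rw [weight, eval, cliqueWeight]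
  refine if_congr (eval_near hG (by decide) h0 h1) ?_ rfl
  set M := (Finset.univ : Finset (Fin n × Fin n)).sup fun xy =>
    if IsNearClique G (commonInside G p xy.1 xy.2) then (commonInside G p xy.1 xy.2).card else 0
    with hM
  have hMn : M ≤ n := Finset.sup_le fun xy _ => by
    split_ifs
    · simpa using Finset.card_le_univ (commonInside G p xy.1 xy.2)
    · exact Nat.zero_le n
  have key : ∀ t : Fin n, (sum 11 (.sum 12 (and commonClique (.sub commonCard (.var 10))))).eval n
      (m.setReg 10 t) ≠ 0 ↔ (t : ℕ) < M := fun t => by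
    rw [hM, Finset.lt_sup_iff, eval_sum_ne_zero]
    simp only [eval_sum_ne_zero, Finset.mem_univ, true_and, Prod.exists]
    refine exists_congr fun x => exists_congr fun y => ?_
    have hG' : (((m.setReg 10 t).setReg 11 x).setReg 12 y).HoldsAdj G := hG
    rw [eval_and_ne_zero, eval_commonClique (p := p) (x := x) (y := y) hG' (by simpa [State.setReg])
      (by simpa [State.setReg]) (by simp [State.setReg]) (by simp [State.setReg]),
      eval, eval_commonCard (p := p) (x := x) (y := y) hG' (by simpa [State.setReg])
      (by simpa [State.setReg]) (by simp [State.setReg]) (by simp [State.setReg])]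
    have : BoundedExpr.eval n (.var 10) (((m.setReg 10 t).setReg 11 x).setReg 12 y) = t := by
      simp [eval, State.setReg]
    rw [this]
    split_ifs with hc
    · simp only [hc, true_and]
      omega
    · simp [hc]
  rw [eval]
  simp only [eval.eq_6, key, eval.eq_1]
  rw [Finset.sum_boole, Nat.cast_id]
  have : (Finset.univ.filter fun t : Fin n => (t : ℕ) < M).card = M := by
    rw [Fin.card_filter_val_lt]
    omega
  exact this

theorem eval_entry {w : Fin n × Fin n → ℕ} (hw : ∀ i j : Fin n, m.arr 1 (n * i + j) = w (i, j))
    {i j : ℕ} {p : Fin n × Fin n} (hi : i ≠ 7) (h1 : m.reg i = p.1) (h2 : m.reg j = p.2) :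
    (entry i j).eval n m = w p := by
  rw [entry, eval, eval_index hi h1 h2, hw]

theorem eval_simplicial (hG : m.HoldsAdj G) {w : Fin n × Fin n → ℕ}
    (hw : ∀ i j : Fin n, m.arr 1 (n * i + j) = w (i, j)) {p : Fin n × Fin n}
    (h0 : m.reg 0 = p.1) (h1 : m.reg 1 = p.2) :
    simplicial.eval n m ≠ 0 ↔ IsSimplicial (Conflict G) w p := by
  have key : ∀ a b c d : Fin n, (imp (entry 2 3) (imp (entry 4 5)
      (imp (conflict 0 1 2 3) (imp (conflict 0 1 4 5) (conflict 2 3 4 5))))).eval n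
      ((((m.setReg 2 a).setReg 3 b).setReg 4 c).setReg 5 d) ≠ 0 ↔
      (w (a, b) ≠ 0 → w (c, d) ≠ 0 → Conflict G p (a, b) → Conflict G p (c, d) →
        Conflict G (a, b) (c, d)) := fun a b c d => by
    set m' := (((m.setReg 2 a).setReg 3 b).setReg 4 c).setReg 5 d with hm'
    have hG' : m'.HoldsAdj G := hG
    have hw' : ∀ i j : Fin n, m'.arr 1 (n * i + j) = w (i, j) := hw
    have e0 : m'.reg 0 = p.1 := by simpa [hm', State.setReg]
    have e1 : m'.reg 1 = p.2 := by simpa [hm', State.setReg]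
    have e2 : m'.reg 2 = (a, b).1 := by simp [hm', State.setReg]
    have e3 : m'.reg 3 = (a, b).2 := by simp [hm', State.setReg]
    have e4 : m'.reg 4 = (c, d).1 := by simp [hm', State.setReg]
    have e5 : m'.reg 5 = (c, d).2 := by simp [hm', State.setReg]
    simp only [eval_imp_ne_zero]
    rw [eval_entry hw' (by decide) e2 e3, eval_entry hw' (by decide) e4 e5,
      eval_conflict hG' (by decide) (by decide) (by decide) (by decide) e0 e1 e2 e3,
      eval_conflict hG' (by decide) (by decide) (by decide) (by decide) e0 e1 e4 e5,
      eval_conflict hG' (by decide) (by decide) (by decide) (by decide) e2 e3 e4 e5]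
  rw [simplicial, eval_and_ne_zero, eval_entry hw (by decide) h0 h1]
  simp only [eval_all_ne_zero, key, IsSimplicial, Prod.forall]

end BoundedExpr

/-! ### Correctness of the elimination program. -/

namespace BoundedProg

open BoundedExpr

variable {n : ℕ}

theorem run_forLoop_induction {x : ℕ} {P : BoundedProg} (I : ℕ → State → Prop)
    (hP : ∀ (i : Fin n) m, I i m → I (i + 1) (P.run n (m.setReg x i))) {m : State} (h0 : I 0 m) :
    I n ((forLoop x P).run n m) := by
  rw [run]
  suffices H : ∀ k ≤ n, I k ((List.range k).foldl (fun s i => P.run n (s.setReg x i)) m) from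
    H n le_rfl
  intro k hk
  induction k with
  | zero => exact h0
  | succ k ih =>
    rw [List.range_succ, List.foldl_append]
    exact hP ⟨k, hk⟩ _ (ih (by omega))

theorem run_forLoop_foldl {α : Type*} {x : ℕ} {P : BoundedProg} (R : α → State → Prop)
    (f : α → Fin n → α) (hP : ∀ (i : Fin n) a m, R a m → R (f a i) (P.run n (m.setReg x i)))
    {a : α} {m : State} (h0 : R a m) :
    R ((List.finRange n).foldl f a) ((forLoop x P).run n m) := by
  rw [run, ← List.map_coe_finRange_eq_range, List.foldl_map]
  generalize List.finRange n = L
  induction L generalizing a m with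
  | nil => exact h0
  | cons i L ih => exact ih (hP i a m h0)

/-- Fill the table in array `1` with the values of `e`, with the pair of variables `(x, y)` running
over all pairs. -/
def table (x y : ℕ) (e : BoundedExpr) : BoundedProg :=
  .forLoop x (.forLoop y (.write 1 (index x y) e))

/-- Cells are written in row-major order, so `e` may use the old value of the very cell being
written. This allows updating the weights in place. -/
theorem run_table {x y : ℕ} (hxy : x ≠ y) (hx : x ≠ 7) {e : BoundedExpr} {m : State}
    {F : Fin n → Fin n → ℕ}
    (he : ∀ (i j : Fin n) (m' : State), m'.arr 0 = m.arr 0 →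
      (∀ z, z ≠ x → z ≠ y → m'.reg z = m.reg z) → m'.reg x = i → m'.reg y = j →
      m'.arr 1 (n * i + j) = m.arr 1 (n * i + j) → e.eval n m' = F i j) :
    ((table x y e).run n m).arr 0 = m.arr 0 ∧
    (∀ z, z ≠ x → z ≠ y → ((table x y e).run n m).reg z = m.reg z) ∧
    ∀ i j : Fin n, ((table x y e).run n m).arr 1 (n * i + j) = F i j := by
  let I : ℕ → State → Prop := fun k m' => m'.arr 0 = m.arr 0 ∧
    (∀ z, z ≠ x → z ≠ y → m'.reg z = m.reg z) ∧
    ∀ i j : Fin n, m'.arr 1 (n * i + j) =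
      if n * (i : ℕ) + j < k then F i j else m.arr 1 (n * i + j)
  have main : I (n * n) ((table x y e).run n m) := by
    refine run_forLoop_induction (fun k => I (n * k)) ?_ ⟨rfl, fun _ _ _ => rfl, by simp⟩
    rintro i m₁ ⟨h1, h2, h3⟩
    have inner := run_forLoop_induction (n := n) (x := y) (P := .write 1 (index x y) e)
      (m := m₁.setReg x i) (fun k m' => I (n * i + k) m' ∧ m'.reg x = i) ?_
      ⟨⟨h1, fun z hzx hzy => by rw [State.reg_setReg_of_ne _ _ hzx, h2 z hzx hzy], h3⟩,
        State.reg_setReg_self _ _ _⟩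
    · exact inner.1
    rintro j m₂ ⟨⟨g1, g2, g3⟩, g4⟩
    have ex : (m₂.setReg y j).reg x = i := by rw [State.reg_setReg_of_ne _ _ hxy, g4]
    have ey : (m₂.setReg y j).reg y = j := State.reg_setReg_self _ _ _
    have ez : ∀ z, z ≠ x → z ≠ y → (m₂.setReg y j).reg z = m.reg z := fun z hzx hzy => by
      rw [State.reg_setReg_of_ne _ _ hzy, g2 z hzx hzy]
    have ev : e.eval n (m₂.setReg y j) = F i j :=
      he i j _ g1 ez ex ey (by rw [State.arr_setReg, g3]; simp)
    rw [run, eval_index hx ex ey, ev]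
    refine ⟨⟨?_, ez, fun i' j' => ?_⟩, ex⟩
    · simpa [State.setArr] using g1
    · by_cases hc : n * (i' : ℕ) + j' = n * i + j
      · obtain ⟨rfl, rfl⟩ := pair_code_inj hc
        simp [State.setArr]
      · simp only [State.setArr, Function.update_self, Function.update_of_ne hc, State.arr_setReg,
          g3]
        refine if_congr ?_ rfl rfl
        omega
  refine ⟨main.1, main.2.1, fun i j => ?_⟩
  rw [main.2.2, if_pos]
  have := Nat.mul_le_mul_left n i.isLt
  rw [Nat.mul_succ] at this
  omega

/-- Eliminate the pair `(0, 1)`, keeping the total in variable `9`. -/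
def eliminatePair : BoundedProg :=
  .seq (.set 8 (.ite simplicial (entry 0 1) (.const 0)))
    (.seq (.set 9 (.add (.var 9) (.var 8)))
      (table 2 3 (.sub (entry 2 3) (.ite (conflict 0 1 2 3) (.var 8) (.const 0)))))

/-- Compute the separated-cluster number into variable `9`. -/
def separatedCluster : BoundedProg :=
  .seq (table 0 1 weight) (.forLoop 17 (.forLoop 18 (.forLoop 0 (.forLoop 1 eliminatePair))))

variable {G : SimpleGraph (Fin n)}

/-- The state `m` holds the graph `G`, the weights `x.1` and the total `x.2`. -/
def Holds (G : SimpleGraph (Fin n)) (x : (Fin n × Fin n → ℕ) × ℕ) (m : State) : Prop :=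
  m.HoldsAdj G ∧ (∀ i j : Fin n, m.arr 1 (n * i + j) = x.1 (i, j)) ∧ m.reg 9 = x.2

theorem Holds.setReg {x : (Fin n × Fin n → ℕ) × ℕ} {m : State} (h : Holds G x m) {y : ℕ}
    (hy : 9 ≠ y) (v : ℕ) : Holds G x (m.setReg y v) :=
  ⟨h.1, h.2.1, (State.reg_setReg_of_ne m v hy).trans h.2.2⟩

/-- The gain is saved in variable 8 before any weight changes, as the simpliciality test reads the
table being updated. Variable 0 is tracked because the inner loop over variable 1 relies on it. -/
theorem holds_run_eliminatePair {x : (Fin n × Fin n → ℕ) × ℕ} {m : State} (h : Holds G x m)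
    {p : Fin n × Fin n} (h0 : m.reg 0 = p.1) (h1 : m.reg 1 = p.2) :
    Holds G (eliminate (Conflict G) x p) (eliminatePair.run n m) ∧
      (eliminatePair.run n m).reg 0 = p.1 := by
  classical
  obtain ⟨hG, hw, h9⟩ := h
  have hgain : (BoundedExpr.ite simplicial (entry 0 1) (.const 0)).eval n m =
      gain (Conflict G) x.1 p := by
    rw [BoundedExpr.eval, gain]
    exact if_congr (eval_simplicial hG hw h0 h1) (eval_entry hw (by decide) h0 h1) rfl
  have hrun : eliminatePair.run n m =
      (table 2 3 (.sub (entry 2 3) (.ite (conflict 0 1 2 3) (.var 8) (.const 0)))).run n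
        ((m.setReg 8 (gain (Conflict G) x.1 p)).setReg 9 (x.2 + gain (Conflict G) x.1 p)) := by
    simp only [eliminatePair, run, hgain]
    simp [BoundedExpr.eval, State.setReg, h9]
  rw [hrun]
  set m₁ := (m.setReg 8 (gain (Conflict G) x.1 p)).setReg 9 (x.2 + gain (Conflict G) x.1 p) with hm₁
  obtain ⟨t1, t2, t3⟩ := run_table (n := n) (x := 2) (y := 3) (by decide) (by decide) (m := m₁)
    (e := .sub (entry 2 3) (.ite (conflict 0 1 2 3) (.var 8) (.const 0)))
    (F := fun i j => (eliminate (Conflict G) x p).1 (i, j)) (by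
      intro i j m' ha hr hi hj he
      have hG' : m'.HoldsAdj G := fun u v => by rw [ha]; exact hG u v
      have e0 : m'.reg 0 = p.1 := by
        rw [hr 0 (by decide) (by decide)]
        simpa [hm₁, State.setReg]
      have e1 : m'.reg 1 = p.2 := by
        rw [hr 1 (by decide) (by decide)]
        simpa [hm₁, State.setReg]
      have e8 : m'.reg 8 = gain (Conflict G) x.1 p := by
        rw [hr 8 (by decide) (by decide)]
        simp [hm₁, State.setReg]
      have ee : (entry 2 3).eval n m' = x.1 (i, j) := by
        rw [entry, BoundedExpr.eval, eval_index (by decide) hi hj, he]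
        exact hw i j
      rw [BoundedExpr.eval, BoundedExpr.eval, ee, eliminate]
      simp only [BoundedExpr.eval, e8]
      congr 1
      exact if_congr (eval_conflict (q := (i, j)) hG' (by decide) (by decide) (by decide)
        (by decide) e0 e1 hi hj) rfl rfl)
  refine ⟨⟨fun u v => ?_, t3, ?_⟩, ?_⟩
  · rw [t1]
    exact hG u v
  · rw [t2 9 (by decide) (by decide)]
    simp [hm₁, State.setReg, eliminate]
  · rw [t2 0 (by decide) (by decide)]
    simpa [hm₁, State.setReg]

theorem run_separatedCluster (hG : IsIntervalGraph G) {m : State} (hm : m.HoldsAdj G)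
    (h9 : m.reg 9 = 0) :
    (separatedCluster.run n m).reg 9 = maxWeight (Conflict G) (cliqueWeight G) := by
  have hinit : Holds G (cliqueWeight G, 0) ((table 0 1 weight).run n m) := by
    obtain ⟨t1, t2, t3⟩ := run_table (n := n) (x := 0) (y := 1) (by decide) (by decide) (m := m)
      (e := weight) (F := fun i j => cliqueWeight G (i, j)) (by
        intro i j m' ha hr hi hj he
        exact eval_weight (fun u v => by rw [ha]; exact hm u v) hi hj)
    refine ⟨fun u v => ?_, t3, ?_⟩
    · rw [t1]
      exact hm u v
    · rw [t2 9 (by decide) (by decide), h9]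
  set L : List (Fin n × Fin n) := List.finRange n ×ˢ List.finRange n with hL
  set F : (Fin n × Fin n → ℕ) × ℕ → (Fin n × Fin n → ℕ) × ℕ :=
    fun x => L.foldl (eliminate (Conflict G)) x with hF
  have hpass : ∀ x m, Holds G x m →
      Holds G (F x) ((forLoop 0 (forLoop 1 eliminatePair)).run n m) := by
    intro x m hx
    have := run_forLoop_foldl (n := n) (x := 0) (P := forLoop 1 eliminatePair) (Holds G)
      (fun x u => (List.finRange n).foldl (fun x v => eliminate (Conflict G) x (u, v)) x) ?_ hx
    · convert this using 1
      simp only [hF, hL, SProd.sprod, List.product, List.foldl_flatMap, List.foldl_map]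
    · intro u x m hx
      exact (run_forLoop_foldl (n := n) (x := 1) (P := eliminatePair)
        (fun x m => Holds G x m ∧ m.reg 0 = u) (fun x v => eliminate (Conflict G) x (u, v))
        (fun v x m h => holds_run_eliminatePair (h.1.setReg (by decide) _)
          (by rw [State.reg_setReg_of_ne _ _ (by decide), h.2]) (State.reg_setReg_self _ _ _))
        ⟨hx.setReg (by decide) _, State.reg_setReg_self _ _ _⟩).1
  -- The loops over 17 and 18 only count: n · n passes, one for each pair of vertices.
  have hiter : Holds G ((F^[n])^[n] (cliqueWeight G, 0)) (separatedCluster.run n m) := by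
    have hrep : ∀ (f : (Fin n × Fin n → ℕ) × ℕ → (Fin n × Fin n → ℕ) × ℕ) (P : BoundedProg)
        (y : ℕ), 9 ≠ y → (∀ x m, Holds G x m → Holds G (f x) (P.run n m)) →
        ∀ x m, Holds G x m → Holds G (f^[n] x) ((forLoop y P).run n m) := by
      intro f P y hy hP x m hx
      refine run_forLoop_induction (fun k => Holds G (f^[k] x)) (fun i m h => ?_) hx
      rw [Function.iterate_succ_apply']
      exact hP _ _ (h.setReg hy _)
    exact hrep _ _ 17 (by decide) (hrep _ _ 18 (by decide) hpass) _ _ hinit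
  rw [hiter.2.2, ← Function.iterate_mul]
  refine iterate_foldl_eliminate Conflict.refl (fun _ _ => Conflict.symm) (fun w hw hw0 => ?_)
    (fun p => ?_) (by simp)
  -- Pairs that are not near have weight 0 from the start, and weights never grow.
  · refine hG.exists_isSimplicial (fun p hp => ?_) hw0
    by_contra hn
    have := hw p
    simp only [cliqueWeight, if_neg hn] at this
    omega
  · exact List.mem_product.2 ⟨List.mem_finRange _, List.mem_finRange _⟩

end BoundedProg

theorem holdsAdj_vars_inputState {n : ℕ} (G : SimpleGraph (Fin n)) (k : ℕ) :
    (inputState G k).vars.HoldsAdj G := by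
  intro u v
  simp only [State.vars, inputState, true_and, ne_eq, ite_eq_right_iff, one_ne_zero, imp_false,
    not_not]
  constructor
  · rintro ⟨u', v', h, hadj⟩
    obtain ⟨rfl, rfl⟩ := pair_code_inj h
    exact hadj
  · exact fun h => ⟨u, v, rfl, h⟩

/-- A machine program that computes the separated-cluster number of interval graphs into
register `20` in polynomial time, keeping register `1`. -/
theorem exists_prog_separatedClusterNumber :
    ∃ (Q : Prog) (p : Polynomial ℕ), ∀ (n : ℕ) (G : SimpleGraph (Fin n)), IsIntervalGraph G →
      ∀ k, ∃ t ≤ p.eval n, ∃ s', Exec Q (inputState G k) t s' ∧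
        s'.reg 20 = separatedClusterNumber G ∧ s'.reg 1 = k := by
  obtain ⟨Q, p, hQ⟩ := BoundedProg.separatedCluster.exists_implementedBy 0
  refine ⟨Q, p, fun n G hG k => ?_⟩
  obtain ⟨t, ht, s', he, hv, -, h1, -⟩ := hQ (inputState G k)
  have h0 : (inputState G k).reg 0 = n := by simp [inputState]
  rw [h0] at ht hv
  refine ⟨t, ht, s', he, ?_, h1.trans (by simp [inputState])⟩
  -- Variable 9 is kept in register 2 · 9 + 2.
  have h20 : s'.reg 20 = s'.vars.reg 9 := rfl
  rw [h20, hv, BoundedProg.run_separatedCluster hG (holdsAdj_vars_inputState G k)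
    (by simp [State.vars, inputState]), separatedClusterNumber]
  exact hG.isGreatest_maxWeight.csSup_eq.symm

end SepCluster

/-! ### The decision and the optimisation program. -/

open SepCluster in
theorem theorem7 :
    (∃ P : SepCluster.Prog,
      SepCluster.DecidesSeparatedCluster P fun _ G => SepCluster.IsIntervalGraph G) ∧
    (∃ P : SepCluster.Prog,
      SepCluster.ComputesSeparatedClusterNumber P fun _ G => SepCluster.IsIntervalGraph G) := by
  classical
  obtain ⟨Q, p, hQ⟩ := exists_prog_separatedClusterNumber
  constructor
  -- With truncated subtraction, 1 - (k - ω) is 1 if k ≤ ω and 0 otherwise; this assignment takes 6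
  -- steps.
  · refine ⟨.seq Q (.assign 0 (.sub (.const 1) (.sub (.reg 1) (.reg 20)))), p + 6,
      fun n G hG k => ?_⟩
    obtain ⟨t, ht, s', he, h20, h1⟩ := hQ n G hG k
    refine ⟨_, ?_, _, Exec.seq he (Exec.assign _ _ _), ?_⟩
    · simp [Expr.cost]
      omega
    · rw [State.reg_setReg_self]
      simp only [Expr.eval, h20, h1]
      have hiff : (∃ S : Finset (Fin n), IsSeparatedCluster G S ∧ k ≤ S.card) ↔
          k ≤ separatedClusterNumber G := by
        have hgr := hG.isGreatest_maxWeight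
        rw [separatedClusterNumber, hgr.csSup_eq]
        constructor
        · rintro ⟨S, hS, hk⟩
          exact hk.trans (hgr.2 ⟨S, hS, rfl⟩)
        · intro hk
          obtain ⟨S, hS, hcard⟩ := hgr.1
          exact ⟨S, hS, hk.trans hcard.ge⟩
      rw [if_congr hiff rfl rfl]
      split_ifs <;> omega
  · refine ⟨.seq Q (.assign 0 (.reg 20)), p + 2, fun n G hG => ?_⟩
    obtain ⟨t, ht, s', he, h20, -⟩ := hQ n G hG 0
    refine ⟨_, ?_, _, Exec.seq he (Exec.assign _ _ _), ?_⟩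
    · simp [Expr.cost]
      omega
    · rw [State.reg_setReg_self, Expr.eval, h20]
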